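/- Let $\mathbb K=\mathbb R$ or $\mathbb C$, let $1\le q\le n$ and let $x_1,\dots,x_n$ be the coordinates of $\mathbb K^n$. Let $\mathcal O$ be one of the following rings of functions: germs at the origin of smooth functions on $\mathbb K^n$; germs at the origin of analytic functions on $\mathbb K^n$; formal power series in $x_1,\dots,x_n$ over $\mathbb K$; smooth functions on all of $\mathbb K^n$; analytic functions on all of $\mathbb K^n$ (derivatives are taken over $\mathbb K$, so for $\mathbb K=\mathbb C$ smooth means holomorphic). All vector fields, multivector fields and differential forms have coefficients in $\mathcal O$. Let $\Omega=u\,dx_1\wedge\dots\wedge dx_n$, with $u\in\mathcal O$ invertible, be a volume form, and let $p=n-q$. A $p$-form $\omega$ is integrable if $\omega\wedge i_A\omega=0$ and $d\omega\wedge i_A\omega=0$ for every $(p-1)$-vector field $A$ (no condition if $p=0$). A $p$-form $\eta$ is an infinitesimal deformation of an integrable $p$-form $\omega$ if $\omega+\varepsilon\eta$ is integrable modulo $\varepsilon^2$, that is, if for every $(p-1)$-vector field $A$ $$\omega\wedge i_A\eta+\eta\wedge i_A\omega=0\quad\text{and}\quad d\omega\wedge i_A\eta+d\eta\wedge i_A\omega=0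 .$$ A $q$-vector field $\Lambda$ is a Nambu structure if $i_\Lambda\Omega$ is integrable. In that case $\mathcal Z(\Lambda)$ denotes the space of its infinitesimal deformations, i.e. of the $q$-vector fields $\Pi$ such that $i_\Pi\Omega$ is an infinitesimal deformation of $i_\Lambda\Omega$; $\mathcal B(\Lambda)$ denotes the space of its trivial deformations $\mathcal L_X\Lambda$, with $X$ a vector field; and the deformation cohomology of $\Lambda$ is $DH(\Lambda)=\mathcal Z(\Lambda)/\mathcal B(\Lambda)$. Then $\Lambda=\dfrac{\partial}{\partial x_1}\wedge\dots\wedge\dfrac{\partial}{\partial x_q}$ is a Nambu structure, $\mathcal B(\Lambda)\subseteq\mathcal Z(\Lambda)$, and $DH(\Lambda)=\{0\}$; that is, every infinitesimal deformation of $\Lambda$ is of the form $\mathcal L_X\Lambda$ for some vector field $X$. -/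

import Mathlib

open scoped Topology

noncomputable section

namespace NambuDeformation

/-! ### Rings of functions with partial derivatives -/

/-- The two kinds of convergent functions: smooth and analytic. Derivatives are taken over the base
field `𝕜`, so that over `ℂ` both are the holomorphic functions. -/
inductive Regularity where
  | smooth : Regularity
  | analytic : Regularity

open scoped ContDiff in
/-- Smooth is `C^∞`, analytic is `C^ω`. -/
def Regularity.order : Regularity → WithTop ℕ∞
  | .smooth => ∞
  | .analytic => ω

section Functions

variable (𝕜 : Type*) [RCLike 𝕜] (n : ℕ) (r : Regularity) (S : Set (Fin n → 𝕜))

/-- Functions on `𝕜ⁿ` that are smooth (analytic) on a neighbourhood of `S`. -/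
def regularFunctions : Subalgebra 𝕜 ((Fin n → 𝕜) → 𝕜) where
  carrier := {f | ∀ᶠ x in 𝓝ˢ S, ContDiffAt 𝕜 r.order f x}
  mul_mem' {f g} hf hg := by
    have hf' : ∀ᶠ x in 𝓝ˢ S, ContDiffAt 𝕜 r.order f x := hf
    have hg' : ∀ᶠ x in 𝓝ˢ S, ContDiffAt 𝕜 r.order g x := hg
    exact (hf'.and hg').mono fun x h => h.1.mul h.2
  add_mem' {f g} hf hg := by
    have hf' : ∀ᶠ x in 𝓝ˢ S, ContDiffAt 𝕜 r.order f x := hf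
    have hg' : ∀ᶠ x in 𝓝ˢ S, ContDiffAt 𝕜 r.order g x := hg
    exact (hf'.and hg').mono fun x h => h.1.add h.2
  algebraMap_mem' c := by
    have h : ∀ᶠ x in 𝓝ˢ S, ContDiffAt 𝕜 r.order (fun _ : Fin n → 𝕜 => c) x :=
      Filter.Eventually.of_forall fun _ => contDiffAt_const
    exact h

/-- The functions that vanish on a neighbourhood of `S`. -/
def vanishingFunctions : Ideal (regularFunctions 𝕜 n r S) where
  carrier := {f | ∀ᶠ x in 𝓝ˢ S, (f : (Fin n → 𝕜) → 𝕜) x = 0}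
  add_mem' {f g} hf hg := by
    have hf' : ∀ᶠ x in 𝓝ˢ S, (f : (Fin n → 𝕜) → 𝕜) x = 0 := hf
    have hg' : ∀ᶠ x in 𝓝ˢ S, (g : (Fin n → 𝕜) → 𝕜) x = 0 := hg
    exact (hf'.and hg').mono fun x h => by simp [h.1, h.2]
  zero_mem' := by
    have h : ∀ᶠ x in 𝓝ˢ S, ((0 : regularFunctions 𝕜 n r S) : (Fin n → 𝕜) → 𝕜) x = 0 :=
      Filter.Eventually.of_forall fun _ => rfl
    exact h
  smul_mem' c f hf := by
    have hf' : ∀ᶠ x in 𝓝ˢ S, (f : (Fin n → 𝕜) → 𝕜) x = 0 := hf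
    exact hf'.mono fun x h => by simp [h]

/-- The ring of germs along `S` of smooth (analytic) functions on `𝕜ⁿ`. For `S = {0}` these are the
germs at the origin; for `S = Set.univ` these are the smooth (analytic) functions on `𝕜ⁿ`. -/
def Germs : Type _ := regularFunctions 𝕜 n r S ⧸ vanishingFunctions 𝕜 n r S

instance : CommRing (Germs 𝕜 n r S) :=
  inferInstanceAs (CommRing (regularFunctions 𝕜 n r S ⧸ vanishingFunctions 𝕜 n r S))

instance : Algebra 𝕜 (Germs 𝕜 n r S) :=
  inferInstanceAs (Algebra 𝕜 (regularFunctions 𝕜 n r S ⧸ vanishingFunctions 𝕜 n r S))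

/-- The germ of a function. -/
def toGerm : regularFunctions 𝕜 n r S →ₐ[𝕜] Germs 𝕜 n r S :=
  Ideal.Quotient.mkₐ 𝕜 (vanishingFunctions 𝕜 n r S)

lemma toGerm_surjective : Function.Surjective (toGerm 𝕜 n r S) :=
  Ideal.Quotient.mkₐ_surjective 𝕜 (vanishingFunctions 𝕜 n r S)

variable {𝕜 n r S} in
lemma toGerm_eq {f g : regularFunctions 𝕜 n r S} :
    toGerm 𝕜 n r S f = toGerm 𝕜 n r S g ↔
      ∀ᶠ x in 𝓝ˢ S, (f : (Fin n → 𝕜) → 𝕜) x = (g : (Fin n → 𝕜) → 𝕜) x := by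
  refine (Ideal.Quotient.eq (I := vanishingFunctions 𝕜 n r S)).trans ?_
  change (∀ᶠ x in 𝓝ˢ S, ((f - g : regularFunctions 𝕜 n r S) : (Fin n → 𝕜) → 𝕜) x = 0) ↔ _
  refine Filter.eventually_congr (Filter.Eventually.of_forall fun x => ?_)
  exact sub_eq_zero

/-- The partial derivative `∂f/∂x_i`. -/
def partialFun (i : Fin n) (f : regularFunctions 𝕜 n r S) : regularFunctions 𝕜 n r S :=
  ⟨fun x => fderiv 𝕜 (f : (Fin n → 𝕜) → 𝕜) x (Pi.single i 1), by
    have hf : ∀ᶠ x in 𝓝ˢ S, ContDiffAt 𝕜 r.order (f : (Fin n → 𝕜) → 𝕜) x := f.2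
    have h1 : r.order + 1 ≤ r.order := by cases r <;> exact le_rfl
    have h2 : ∀ᶠ x in 𝓝ˢ S, ContDiffAt 𝕜 r.order
        (fun x => fderiv 𝕜 (f : (Fin n → 𝕜) → 𝕜) x (Pi.single i 1)) x :=
      hf.mono fun x hx => (hx.fderiv_right h1).clm_apply contDiffAt_const
    exact h2⟩

variable {𝕜 n r S} in
lemma differentiableAt_regularFunctions (f : regularFunctions 𝕜 n r S) :
    ∀ᶠ x in 𝓝ˢ S, DifferentiableAt 𝕜 (f : (Fin n → 𝕜) → 𝕜) x := by
  have hf : ∀ᶠ x in 𝓝ˢ S, ContDiffAt 𝕜 r.order (f : (Fin n → 𝕜) → 𝕜) x := f.2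
  filter_upwards [hf] with x hx
  exact hx.differentiableAt (by cases r <;> simp [Regularity.order])

variable {𝕜 n r S} in
lemma partialFun_congr (i : Fin n) {f g : regularFunctions 𝕜 n r S}
    (h : toGerm 𝕜 n r S f = toGerm 𝕜 n r S g) :
    toGerm 𝕜 n r S (partialFun 𝕜 n r S i f) = toGerm 𝕜 n r S (partialFun 𝕜 n r S i g) := by
  obtain ⟨U, hU, hSU, h0⟩ := eventually_nhdsSet_iff_exists.1 (toGerm_eq.1 h)
  refine toGerm_eq.2 (eventually_nhdsSet_iff_exists.2 ⟨U, hU, hSU, fun x hx => ?_⟩)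
  have h1 : (f : (Fin n → 𝕜) → 𝕜) =ᶠ[𝓝 x] g := by
    filter_upwards [hU.mem_nhds hx] with y hy using h0 y hy
  simp [partialFun, h1.fderiv_eq]

/-- The partial derivative of a germ is the germ of the partial derivative. -/
def germPartialFun (i : Fin n) (a : Germs 𝕜 n r S) : Germs 𝕜 n r S :=
  toGerm 𝕜 n r S (partialFun 𝕜 n r S i (toGerm_surjective 𝕜 n r S a).choose)

lemma germPartialFun_toGerm (i : Fin n) (f : regularFunctions 𝕜 n r S) :
    germPartialFun 𝕜 n r S i (toGerm 𝕜 n r S f) = toGerm 𝕜 n r S (partialFun 𝕜 n r S i f) :=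
  partialFun_congr i (toGerm_surjective 𝕜 n r S (toGerm 𝕜 n r S f)).choose_spec

/-- The partial derivative `∂/∂x_i` on germs, as a derivation. -/
def germPartial (i : Fin n) : Derivation 𝕜 (Germs 𝕜 n r S) (Germs 𝕜 n r S) :=
  Derivation.mk'
    { toFun := germPartialFun 𝕜 n r S i
      map_add' := fun a b => by
        obtain ⟨f, rfl⟩ := toGerm_surjective 𝕜 n r S a
        obtain ⟨g, rfl⟩ := toGerm_surjective 𝕜 n r S b
        rw [← map_add]
        simp only [germPartialFun_toGerm]
        rw [← map_add, toGerm_eq]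
        filter_upwards [differentiableAt_regularFunctions f,
          differentiableAt_regularFunctions g] with x hf hg
        simp [partialFun, fderiv_add hf hg]
      map_smul' := fun c a => by
        obtain ⟨f, rfl⟩ := toGerm_surjective 𝕜 n r S a
        rw [← map_smul]
        simp only [germPartialFun_toGerm, RingHom.id_apply]
        rw [← map_smul, toGerm_eq]
        filter_upwards [differentiableAt_regularFunctions f] with x hf
        simp [partialFun, fderiv_const_smul hf] }
    fun a b => by
      obtain ⟨f, rfl⟩ := toGerm_surjective 𝕜 n r S a
      obtain ⟨g, rfl⟩ := toGerm_surjective 𝕜 n r S b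
      simp only [LinearMap.coe_mk, AddHom.coe_mk, smul_eq_mul]
      rw [← map_mul]
      simp only [germPartialFun_toGerm]
      rw [← map_mul, ← map_mul, ← map_add, toGerm_eq]
      filter_upwards [differentiableAt_regularFunctions f,
        differentiableAt_regularFunctions g] with x hf hg
      simp [partialFun, fderiv_mul hf hg]

end Functions

/-! ### Multivector fields and differential forms over a ring `O` of functions on `𝕜ⁿ`

`O` is one of the rings of functions (smooth, analytic, formal) on `𝕜ⁿ` and `D i` stands for the
partial derivative `∂/∂x_i` of functions. -/

section Tensors

variable {𝕜 : Type*} [Field 𝕜] {O : Type*} [CommRing O] [Algebra 𝕜 O] {n : ℕ}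

variable (O n) in
/-- The vector field `∑ X_i ∂/∂x_i` is given by its components `X_i`. -/
abbrev VField : Type _ := Fin n → O

variable (O n) in
/-- All multivector fields; those of degree `q` are the elements of `⋀[O]^q (VField O n)`. -/
abbrev MultiVec : Type _ := ExteriorAlgebra O (VField O n)

variable (O n) in
/-- All differential forms; those of degree `p` are the elements of
`⋀[O]^p (Module.Dual O (VField O n))`. -/
abbrev DForm : Type _ := ExteriorAlgebra O (Module.Dual O (VField O n))

variable (O) in
/-- The `1`-form `dx_i`. -/
def dx (i : Fin n) : Module.Dual O (VField O n) := LinearMap.proj (φ := fun _ : Fin n => O) i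

variable (O n) in
/-- The basis of multivector fields formed by the `∂/∂x_{i_1} ∧ … ∧ ∂/∂x_{i_k}`, `i_1 < … < i_k`. -/
def multiVecBasis : Module.Basis (Finset (Fin n)) O (MultiVec O n) :=
  (Pi.basisFun O (Fin n)).ExteriorAlgebra

variable (O n) in
/-- The basis of differential forms formed by the `dx_{i_1} ∧ … ∧ dx_{i_k}`, `i_1 < … < i_k`. -/
def formBasis : Module.Basis (Finset (Fin n)) O (DForm O n) :=
  (Pi.basisFun O (Fin n)).dualBasis.ExteriorAlgebra

/-- Apply the derivation `δ` to each coefficient in the basis `b`. -/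
def coeffDeriv {M : Type*} [AddCommGroup M] [Module O M] [Module 𝕜 M] [IsScalarTower 𝕜 O M]
    (b : Module.Basis (Finset (Fin n)) O M) (δ : Derivation 𝕜 O O) : M →ₗ[𝕜] M where
  toFun m := ∑ I, δ (b.repr m I) • b I
  map_add' m m' := by simp [add_smul, Finset.sum_add_distrib]
  map_smul' c m := by
    have h : ∀ I, b.repr (c • m) I = c • b.repr m I := fun I => by
      rw [← algebraMap_smul O c m, map_smul, Finsupp.smul_apply, algebraMap_smul]
    simp [h, Finset.smul_sum]

/-- The exterior derivative, `d(f dx_I) = ∑ i, ∂f/∂x_i dx_i ∧ dx_I`. -/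
def extDer (D : Fin n → Derivation 𝕜 O O) (ω : DForm O n) : DForm O n :=
  ∑ i, ExteriorAlgebra.ι O (dx O i) * coeffDeriv (formBasis O n) (D i) ω

/-- Contraction of a multivector field with the `1`-form `α`: the antiderivation
`i_α (X ∧ A) = α(X) A - X ∧ i_α A`. -/
def contractForm (α : Module.Dual O (VField O n)) : MultiVec O n →ₗ[O] MultiVec O n :=
  CliffordAlgebra.contractLeft α

variable (O n) in
/-- Contraction `i_A ω` of a form `ω` with a multivector field `A`. For a vector field `X`, `i_X` is
the antiderivation with `i_X (α ∧ ω) = α(X) ω - α ∧ i_X ω`, and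
`i_{X_1 ∧ … ∧ X_k} = i_{X_1} ∘ … ∘ i_{X_k}`. (The opposite order of composition changes `i_A` by a
sign that depends only on the degree `k`, which is immaterial below.) -/
def contractMulti : MultiVec O n →ₐ[O] Module.End O (DForm O n) :=
  ExteriorAlgebra.lift O
    ⟨(CliffordAlgebra.contractLeft (Q := (0 : QuadraticForm O (Module.Dual O (VField O n))))) ∘ₗ
      Module.Dual.eval O (VField O n), fun X => by
        refine LinearMap.ext fun ω => ?_
        exact CliffordAlgebra.contractLeft_contractLeft (Q := 0) _ ω⟩

/-- The Lie derivative `L_X Π` of a multivector field along the vector field `X`: `L_X` differentiates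
the coefficients of `Π` along `X`, and acts on the basis vectors by
`L_X (∂/∂x_i) = [X, ∂/∂x_i] = - ∑ k, ∂X_k/∂x_i ∂/∂x_k`, extended as a derivation of the
wedge product. -/
def lieDeriv (D : Fin n → Derivation 𝕜 O O) (X : VField O n) (P : MultiVec O n) : MultiVec O n :=
  ∑ i, (X i • coeffDeriv (multiVecBasis O n) (D i) P -
    ExteriorAlgebra.ι O (fun k => D i (X k)) * contractForm (dx O i) P)

/-- A volume form is an `n`-form `u dx_1 ∧ … ∧ dx_n` with `u` an invertible function. -/
def IsVolumeForm (Ω : DForm O n) : Prop :=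
  ∃ u : Oˣ, Ω = (u : O) • ExteriorAlgebra.ιMulti O n (dx O)

/-- Integrable `p`-forms: `ω ∧ i_A ω = 0` and `dω ∧ i_A ω = 0` for each `(p-1)`-vector field `A`. -/
def IsIntegrable (D : Fin n → Derivation 𝕜 O O) (p : ℕ) (ω : DForm O n) : Prop :=
  ω ∈ ⋀[O]^p (Module.Dual O (VField O n)) ∧
    ∀ s : ℕ, s + 1 = p → ∀ A ∈ ⋀[O]^s (VField O n),
      ω * contractMulti O n A ω = 0 ∧ extDer D ω * contractMulti O n A ω = 0

/-- Infinitesimal deformations `η` of a `p`-form `ω`: `ω + ε η` is integrable modulo `ε²`. Here `ω`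
is integrable, so that only the coefficient of `ε` has to vanish in
`(ω + ε η) ∧ i_A (ω + ε η)` and in `d(ω + ε η) ∧ i_A (ω + ε η)`. -/
def IsInfinitesimalDeformation (D : Fin n → Derivation 𝕜 O O) (p : ℕ) (ω η : DForm O n) : Prop :=
  η ∈ ⋀[O]^p (Module.Dual O (VField O n)) ∧
    ∀ s : ℕ, s + 1 = p → ∀ A ∈ ⋀[O]^s (VField O n),
      ω * contractMulti O n A η + η * contractMulti O n A ω = 0 ∧
      extDer D ω * contractMulti O n A η + extDer D η * contractMulti O n A ω = 0

/-- Nambu structures of order `q ≤ n`: `q`-vector fields `L` for which `i_L Ω` is an integrable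
`(n-q)`-form. -/
def IsNambu (D : Fin n → Derivation 𝕜 O O) (Ω : DForm O n) (q : ℕ) (L : MultiVec O n) : Prop :=
  L ∈ ⋀[O]^q (VField O n) ∧ IsIntegrable D (n - q) (contractMulti O n L Ω)

lemma extDer_add (D : Fin n → Derivation 𝕜 O O) (ω η : DForm O n) :
    extDer D (ω + η) = extDer D ω + extDer D η := by
  simp [extDer, mul_add, Finset.sum_add_distrib]

lemma extDer_smul (D : Fin n → Derivation 𝕜 O O) (c : 𝕜) (ω : DForm O n) :
    extDer D (c • ω) = c • extDer D ω := by
  simp [extDer, Finset.smul_sum]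

lemma contractMulti_smul (c : 𝕜) (A : MultiVec O n) (ω : DForm O n) :
    contractMulti O n A (c • ω) = c • contractMulti O n A ω := by
  rw [← algebraMap_smul O c ω, map_smul, algebraMap_smul]

lemma contractMulti_smul_left (c : 𝕜) (A : MultiVec O n) (ω : DForm O n) :
    contractMulti O n (c • A) ω = c • contractMulti O n A ω := by
  rw [← algebraMap_smul O c A, map_smul, LinearMap.smul_apply, algebraMap_smul]

lemma lieDeriv_add_left (D : Fin n → Derivation 𝕜 O O) (X Y : VField O n) (P : MultiVec O n) :
    lieDeriv D (X + Y) P = lieDeriv D X P + lieDeriv D Y P := by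
  have h : ∀ i, (fun k => D i ((X + Y) k)) = (fun k => D i (X k)) + fun k => D i (Y k) := by
    intro i; ext k; simp
  simp only [lieDeriv]
  simp_rw [h]
  simp only [map_add, add_mul, Pi.add_apply, add_smul, ← Finset.sum_add_distrib]
  exact Finset.sum_congr rfl fun i _ => by abel

lemma lieDeriv_smul_left (D : Fin n → Derivation 𝕜 O O) (c : 𝕜) (X : VField O n)
    (P : MultiVec O n) : lieDeriv D (c • X) P = c • lieDeriv D X P := by
  have h : ∀ i, ExteriorAlgebra.ι O (fun k => D i ((c • X) k)) =
      c • ExteriorAlgebra.ι O (fun k => D i (X k)) := by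
    intro i
    rw [← algebraMap_smul O c (ExteriorAlgebra.ι O _), ← map_smul]
    congr 1
    ext k
    simp [Algebra.smul_def]
  simp only [lieDeriv]
  simp_rw [h]
  simp only [Pi.smul_apply, smul_assoc, Finset.smul_sum, smul_sub, smul_mul_assoc]

/-- `Z(L)`: the infinitesimal deformations of a Nambu structure `L` of order `q ≤ n`, i.e. the
`q`-vector fields `P` such that `i_P Ω` is an infinitesimal deformation of `i_L Ω`. -/
def infinitesimalDeformations (D : Fin n → Derivation 𝕜 O O) (Ω : DForm O n) (q : ℕ)
    (L : MultiVec O n) : Submodule 𝕜 (MultiVec O n) where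
  carrier := {P | P ∈ ⋀[O]^q (VField O n) ∧
    IsInfinitesimalDeformation D (n - q) (contractMulti O n L Ω) (contractMulti O n P Ω)}
  add_mem' := by
    rintro P Q ⟨hP, hP', hP''⟩ ⟨hQ, hQ', hQ''⟩
    refine ⟨add_mem hP hQ, ?_, fun s hs A hA => ?_⟩
    · rw [map_add, LinearMap.add_apply]
      exact add_mem hP' hQ'
    · obtain ⟨h1, h2⟩ := hP'' s hs A hA
      obtain ⟨h3, h4⟩ := hQ'' s hs A hA
      simp only [map_add, LinearMap.add_apply, extDer_add, mul_add, add_mul]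
      refine ⟨?_, ?_⟩
      · rw [add_add_add_comm, h1, h3, add_zero]
      · rw [add_add_add_comm, h2, h4, add_zero]
  zero_mem' := by
    have h0 : extDer D (0 : DForm O n) = 0 := by simp [extDer]
    refine ⟨zero_mem _, ?_, fun s hs A hA => ?_⟩
    · rw [map_zero, LinearMap.zero_apply]
      exact zero_mem _
    · simp [h0]
  smul_mem' := by
    rintro c P ⟨hP, hP', hP''⟩
    refine ⟨?_, ?_, fun s hs A hA => ?_⟩
    · rw [← algebraMap_smul O c P]
      exact Submodule.smul_mem _ _ hP
    · rw [contractMulti_smul_left, ← algebraMap_smul O c (contractMulti O n P Ω)]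
      exact Submodule.smul_mem _ _ hP'
    · obtain ⟨h1, h2⟩ := hP'' s hs A hA
      simp only [contractMulti_smul_left, contractMulti_smul, extDer_smul, mul_smul_comm, smul_mul_assoc,
        ← smul_add]
      exact ⟨by rw [h1, smul_zero], by rw [h2, smul_zero]⟩

/-- `B(L)`: the trivial deformations `L_X L` of `L`, for `X` a vector field. -/
def trivialDeformations (D : Fin n → Derivation 𝕜 O O) (L : MultiVec O n) :
    Submodule 𝕜 (MultiVec O n) where
  carrier := {P | ∃ X : VField O n, P = lieDeriv D X L}
  add_mem' := by
    rintro _ _ ⟨X, rfl⟩ ⟨Y, rfl⟩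
    exact ⟨X + Y, (lieDeriv_add_left D X Y L).symm⟩
  zero_mem' := ⟨0, by simpa using (lieDeriv_smul_left D (0 : 𝕜) 0 L).symm⟩
  smul_mem' := by
    rintro c _ ⟨X, rfl⟩
    exact ⟨c • X, (lieDeriv_smul_left D c X L).symm⟩

/-- The deformation cohomology `DH(L) = Z(L) / B(L)` of a Nambu structure `L` of order `q`. -/
abbrev DH (D : Fin n → Derivation 𝕜 O O) (Ω : DForm O n) (q : ℕ) (L : MultiVec O n) : Type _ :=
  infinitesimalDeformations D Ω q L ⧸
    (trivialDeformations D L).submoduleOf (infinitesimalDeformations D Ω q L)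

variable (O) in
/-- The constant `q`-vector field `∂/∂x_1 ∧ … ∧ ∂/∂x_q`. -/
def constantNambu {q : ℕ} (hqn : q ≤ n) : MultiVec O n :=
  ExteriorAlgebra.ιMulti O q fun i : Fin q => (Pi.single (Fin.castLE hqn i) 1 : VField O n)

end Tensors

end NambuDeformation

end

/-!
Contraction with `Ω = u dx_1 ∧ … ∧ dx_n` identifies the `q`-vector field `∂_1 ∧ … ∧ ∂_q` with the
decomposable form `± u dx_{q+1} ∧ … ∧ dx_n`, and the conditions on a deformation do not see the
unit `u`, by the Leibniz rule and the decomposability condition.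

Let `Π` be an infinitesimal deformation of `Λ = ∂_1 ∧ … ∧ ∂_q`. The first condition is the
linearization of the Plücker relations at `Λ`, so `Π` is tangent to the orbit of `Λ` under linear
maps: each monomial of `Π` replaces at most one of the factors `∂_a`, `a ≤ q`, by a transversal
`∂_b`, `b > q`. The second condition says that for each `b` the corresponding coefficients form a
closed one-form along the leaves of `Λ`. By the Poincaré lemma along the leaves it has a
primitive, and these primitives are the transversal components of a vector field `X` with
`L_X Λ = Π`, while the coefficient of `Λ` itself in `Π` is absorbed by a multiple of `∂_1`.

The Poincaré lemma reduces to solving `∂_i f = g` with `f` killed by every other `∂_j` that kills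
`g`, which integration along the `i`-th coordinate does. The same integral, being local on the
segment of integration, is analytic whenever `g` is.
-/

namespace NambuDeformation

section ExteriorAlgebra

open ExteriorAlgebra

variable {R M : Type*} [CommRing R] [AddCommGroup M] [Module R M]

/-- The interior product of the exterior algebra with a linear form, which is contraction in the
Clifford algebra of the zero quadratic form. -/
abbrev interiorProd (α : Module.Dual R M) : ExteriorAlgebra R M →ₗ[R] ExteriorAlgebra R M :=
  CliffordAlgebra.contractLeft (Q := (0 : QuadraticForm R M)) α

lemma interiorProd_ι_mul (α : Module.Dual R M) (v : M) (x : ExteriorAlgebra R M) :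
    interiorProd α (ι R v * x) = α v • x - ι R v * interiorProd α x :=
  CliffordAlgebra.contractLeft_ι_mul α v x

lemma interiorProd_algebraMap (α : Module.Dual R M) (r : R) :
    interiorProd α (algebraMap R (ExteriorAlgebra R M) r) = 0 :=
  CliffordAlgebra.contractLeft_algebraMap _ α r

lemma interiorProd_one (α : Module.Dual R M) :
    interiorProd α (1 : ExteriorAlgebra R M) = 0 :=
  CliffordAlgebra.contractLeft_one _ α

lemma interiorProd_comm (α β : Module.Dual R M) (x : ExteriorAlgebra R M) :
    interiorProd α (interiorProd β x) = -interiorProd β (interiorProd α x) :=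
  CliffordAlgebra.contractLeft_comm α β x

lemma ι_mul_ι_mul_swap (v w : M) (x : ExteriorAlgebra R M) :
    ι R v * (ι R w * x) = -(ι R w * (ι R v * x)) := by
  rw [← mul_assoc, eq_neg_of_add_eq_zero_left (ι_add_mul_swap v w), neg_mul, mul_assoc]

lemma ι_mul_interiorProd_of_ι_mul_eq_zero (α : Module.Dual R M) {v : M} {x : ExteriorAlgebra R M}
    (h : ι R v * x = 0) : ι R v * interiorProd α x = α v • x := by
  rw [← sub_eq_zero, ← neg_sub, ← interiorProd_ι_mul, h, map_zero, neg_zero]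

lemma exteriorAlgebra_induction {C : ExteriorAlgebra R M → Prop}
    (algebraMap : ∀ r : R, C (algebraMap R (ExteriorAlgebra R M) r))
    (add : ∀ x y, C x → C y → C (x + y)) (ι_mul : ∀ x v, C x → C (ι R v * x)) (x) : C x :=
  CliffordAlgebra.left_induction (Q := (0 : QuadraticForm R M)) algebraMap add ι_mul x

lemma exteriorPower_induction {C : ℕ → ExteriorAlgebra R M → Prop}
    (algebraMap : ∀ r : R, C 0 (algebraMap R (ExteriorAlgebra R M) r))
    (add : ∀ m x y, C m x → C m y → C m (x + y))
    (ι_mul : ∀ m x v, x ∈ ⋀[R]^m M → C m x → C (m + 1) (ι R v * x)) {m : ℕ} {x}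
    (hx : x ∈ ⋀[R]^m M) : C m x := by
  refine Submodule.pow_induction_on_left' (M := LinearMap.range (ι R : M →ₗ[R] _))
    (C := fun m x _ => C m x) algebraMap (fun x y i _ _ h h' => add i x y h h') ?_ hx
  rintro _ ⟨v, rfl⟩ i x hx h
  exact ι_mul i x v hx h

lemma ι_mul_mem {m : ℕ} {x : ExteriorAlgebra R M} (v : M) (hx : x ∈ ⋀[R]^m M) :
    ι R v * x ∈ ⋀[R]^(m + 1) M := by
  rw [exteriorPower, pow_succ']
  exact Submodule.mul_mem_mul ⟨v, rfl⟩ hx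

lemma exists_eq_ι_of_mem {x : ExteriorAlgebra R M} (hx : x ∈ ⋀[R]^1 M) :
    ∃ v : M, x = ι R v := by
  rw [exteriorPower, pow_one] at hx
  obtain ⟨v, rfl⟩ := hx
  exact ⟨v, rfl⟩

lemma ιMulti_mem {m : ℕ} (v : Fin m → M) : ιMulti R m v ∈ ⋀[R]^m M :=
  ιMulti_range R m ⟨v, rfl⟩

lemma interiorProd_mem (α : Module.Dual R M) {m : ℕ} {x : ExteriorAlgebra R M}
    (hx : x ∈ ⋀[R]^(m + 1) M) : interiorProd α x ∈ ⋀[R]^m M := by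
  refine exteriorPower_induction (C := fun k x => ∀ m, k = m + 1 → interiorProd α x ∈ ⋀[R]^m M)
    (fun r m hm => by simp at hm) (fun k x y hx hy m hm => ?_) (fun k x v hx ih m hm => ?_)
    hx m rfl
  · rw [map_add]
    exact add_mem (hx m hm) (hy m hm)
  · obtain rfl : k = m := by omega
    rw [interiorProd_ι_mul]
    refine sub_mem (Submodule.smul_mem _ _ hx) ?_
    cases k with
    | zero =>
      obtain ⟨r, rfl⟩ := Submodule.mem_one.1 hx
      rw [interiorProd_algebraMap, mul_zero]
      exact zero_mem _
    | succ k => exact ι_mul_mem v (ih k rfl)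

lemma mul_ι_of_mem {m : ℕ} {x : ExteriorAlgebra R M} (hx : x ∈ ⋀[R]^m M) (v : M) :
    x * ι R v = (-1 : R) ^ m • (ι R v * x) := by
  refine exteriorPower_induction
    (C := fun m x => x * ι R v = (-1 : R) ^ m • (ι R v * x)) (fun r => ?_) ?_ ?_ hx
  · rw [pow_zero, one_smul, Algebra.commutes]
  · intro m x y hx hy
    rw [add_mul, hx, hy, mul_add, smul_add]
  · intro m x w _ h
    rw [mul_assoc, h, mul_smul_comm, ι_mul_ι_mul_swap, pow_succ, mul_neg_one, neg_smul, smul_neg]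

lemma mul_ι_eq_zero_iff {m : ℕ} {x : ExteriorAlgebra R M} (hx : x ∈ ⋀[R]^m M) (v : M) :
    x * ι R v = 0 ↔ ι R v * x = 0 := by
  rw [mul_ι_of_mem hx, (isUnit_neg_one.pow m).smul_eq_zero]

lemma ι_mul_ιMulti_eq_zero {m : ℕ} (v : Fin m → M) (i : Fin m) :
    ι R (v i) * ιMulti R m v = 0 := by
  rw [ιMulti_apply]
  exact ι_mul_prod_list v i

lemma interiorProd_ιMulti_eq_zero (α : Module.Dual R M) {m : ℕ} (v : Fin m → M)
    (h : ∀ i, α (v i) = 0) : interiorProd α (ιMulti R m v) = 0 := by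
  induction m with
  | zero => rw [ιMulti_zero_apply, interiorProd_one]
  | succ m ih =>
    rw [ιMulti_succ_apply, interiorProd_ι_mul, h, zero_smul, zero_sub,
      ih (Matrix.vecTail v) fun i => h i.succ, mul_zero, neg_zero]

-- `x ↦ v ∧ i_α x` is the derivation extending the rank one endomorphism `α(·) v`.
lemma ι_mul_interiorProd_mul (α : Module.Dual R M) (v : M) (x y : ExteriorAlgebra R M) :
    ι R v * interiorProd α (x * y) =
      ι R v * interiorProd α x * y + x * (ι R v * interiorProd α y) := by
  refine exteriorAlgebra_induction (C := fun x => ι R v * interiorProd α (x * y) =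
    ι R v * interiorProd α x * y + x * (ι R v * interiorProd α y)) (fun r => ?_) ?_ ?_ x
  · rw [interiorProd_algebraMap, mul_zero, zero_mul, zero_add, ← Algebra.smul_def, map_smul,
      mul_smul_comm, Algebra.smul_def]
  · intro x z hx hz
    rw [add_mul, map_add, mul_add, hx, hz, map_add, mul_add, add_mul, add_mul]
    abel
  · intro x w h
    rw [mul_assoc, interiorProd_ι_mul, interiorProd_ι_mul, mul_sub, mul_sub, ι_mul_ι_mul_swap, h,
      sub_mul, mul_smul_comm, mul_smul_comm, ι_mul_ι_mul_swap v w (interiorProd α x)]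
    simp only [mul_add, smul_mul_assoc, mul_assoc, neg_mul]
    abel

section Basis

variable {κ : Type*} [LinearOrder κ] (b : Module.Basis κ R M)

lemma basis_mem_exteriorPower (I : Finset κ) : b.ExteriorAlgebra I ∈ ⋀[R]^I.card M := by
  rw [basis_apply]
  exact ιMulti_mem _

lemma basis_empty : b.ExteriorAlgebra ∅ = 1 := by
  rw [basis_apply_ofCard b Finset.card_empty]
  exact ιMulti_zero_apply _

lemma basis_singleton (i : κ) : b.ExteriorAlgebra {i} = ι R (b i) := by
  have hcard : ({i} : Finset κ).card = 1 := Finset.card_singleton i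
  rw [basis_apply_ofCard b hcard, ιMulti_family, ιMulti_succ_apply, ιMulti_zero_apply, mul_one]
  exact congrArg (fun k => ι R (b k))
    (Finset.mem_singleton.1 (Finset.orderEmbOfFin_mem {i} hcard 0))

lemma ι_mul_basis_of_mem {i : κ} {I : Finset κ} (hi : i ∈ I) :
    ι R (b i) * b.ExteriorAlgebra I = 0 := by
  rw [← basis_singleton]
  refine basis_mul_of_not_disjoint b (Set.powersetCard.ofCard (Finset.card_singleton i))
    (Set.powersetCard.ofCard (rfl : I.card = _)) ?_
  exact fun h => Finset.disjoint_singleton_left.1 h hi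

lemma exists_ι_mul_basis_of_notMem {i : κ} {I : Finset κ} (hi : i ∉ I) :
    ∃ ε : ℤˣ, ι R (b i) * b.ExteriorAlgebra I = ε • b.ExteriorAlgebra (insert i I) := by
  have h_mul := basis_mul_of_disjoint b (Set.powersetCard.ofCard (Finset.card_singleton i))
    (Set.powersetCard.ofCard (rfl : I.card = _)) (Finset.disjoint_singleton_left.2 hi)
  refine ⟨_, Eq.trans ?_ (h_mul.trans (congrArg (_ • b.ExteriorAlgebra ·) ?_))⟩
  · rw [← basis_singleton]
    rfl
  · rw [Finset.insert_eq, ← Finset.disjUnion_eq_union _ _ (Finset.disjoint_singleton_left.2 hi)]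
    rfl

lemma exists_basis_insert {i : κ} {I : Finset κ} (hi : i ∉ I) :
    ∃ ε : ℤˣ, b.ExteriorAlgebra (insert i I) = ε • (ι R (b i) * b.ExteriorAlgebra I) := by
  obtain ⟨ε, hε⟩ := exists_ι_mul_basis_of_notMem b hi
  exact ⟨ε, by rw [hε, smul_smul, Int.units_mul_self, one_smul]⟩

lemma exists_ιMulti_comp_basis {m : ℕ} {g : Fin m → κ} (hg : Function.Injective g) :
    ∃ ε : ℤˣ, ιMulti R m (b ∘ g) = ε • b.ExteriorAlgebra (Finset.univ.image g) := by
  induction m with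
  | zero => exact ⟨1, by rw [ιMulti_zero_apply, Finset.univ_eq_empty, Finset.image_empty,
      basis_empty, one_smul]⟩
  | succ m ih =>
    obtain ⟨ε, hε⟩ := ih (hg.comp (Fin.succ_injective m))
    have h_notMem : g 0 ∉ Finset.univ.image (g ∘ Fin.succ) := by
      simp [hg.eq_iff]
    have h_image : Finset.univ.image g = insert (g 0) (Finset.univ.image (g ∘ Fin.succ)) := by
      ext i
      simp [Fin.exists_fin_succ, eq_comm]
    obtain ⟨ε', hε'⟩ := exists_ι_mul_basis_of_notMem b h_notMem
    refine ⟨ε * ε', ?_⟩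
    rw [ιMulti_succ_apply, h_image, mul_smul, ← hε', ← mul_smul_comm, ← hε]
    rfl

lemma interiorProd_basis_of_notMem {i : κ} {I : Finset κ} (hi : i ∉ I) :
    interiorProd (b.coord i) (b.ExteriorAlgebra I) = 0 := by
  rw [basis_apply]
  refine interiorProd_ιMulti_eq_zero _ _ fun k => ?_
  have hk : I.orderEmbOfFin rfl k ≠ i := fun h => hi (h ▸ Finset.orderEmbOfFin_mem _ _ _)
  change b.repr (b (I.orderEmbOfFin rfl k)) i = 0
  rw [b.repr_self, Finsupp.single_eq_of_ne hk.symm]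

lemma exists_interiorProd_basis_of_mem {i : κ} {I : Finset κ} (hi : i ∈ I) :
    ∃ ε : ℤˣ, interiorProd (b.coord i) (b.ExteriorAlgebra I) =
      ε • b.ExteriorAlgebra (I.erase i) := by
  obtain ⟨ε, hε⟩ := exists_basis_insert b (Finset.notMem_erase i I)
  rw [Finset.insert_erase hi] at hε
  refine ⟨ε, ?_⟩
  rw [hε, LinearMap.map_smul_of_tower, interiorProd_ι_mul,
    interiorProd_basis_of_notMem b (Finset.notMem_erase i I)]
  simp

lemma exteriorPower_eq_span_basis (m : ℕ) :
    ⋀[R]^m M = Submodule.span R (b.ExteriorAlgebra '' {I | I.card = m}) := by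
  rw [← Submodule.map_subtype_top (⋀[R]^m M), ← (b.exteriorPower m).span_eq, Submodule.map_span]
  congr 1
  ext x
  constructor
  · rintro ⟨_, ⟨I, rfl⟩, rfl⟩
    exact ⟨I, I.2, basis_eq_coe_basis b I⟩
  · rintro ⟨I, hI, rfl⟩
    exact ⟨_, ⟨⟨I, hI⟩, rfl⟩, (basis_eq_coe_basis b ⟨I, hI⟩).symm⟩

lemma repr_eq_zero_of_mem_exteriorPower {m : ℕ} {x : ExteriorAlgebra R M} (hx : x ∈ ⋀[R]^m M)
    {I : Finset κ} (hI : I.card ≠ m) : b.ExteriorAlgebra.repr x I = 0 := by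
  rw [exteriorPower_eq_span_basis b, Module.Basis.mem_span_image] at hx
  exact Finsupp.notMem_support_iff.1 fun h => hI (hx h)

lemma repr_eq_zero_of_interiorProd_eq_zero {i : κ} {x : ExteriorAlgebra R M}
    (hx : interiorProd (b.coord i) x = 0) {I : Finset κ} (hi : i ∈ I) :
    b.ExteriorAlgebra.repr x I = 0 := by
  have hx_eq : x = interiorProd (b.coord i) (ι R (b i) * x) := by
    rw [interiorProd_ι_mul, hx, mul_zero, sub_zero]
    simp
  suffices h : ∀ y, b.ExteriorAlgebra.coord I (interiorProd (b.coord i) (ι R (b i) * y)) = 0 by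
    rw [hx_eq]
    exact h x
  refine LinearMap.congr_fun (f := b.ExteriorAlgebra.coord I ∘ₗ interiorProd (b.coord i) ∘ₗ
    LinearMap.mulLeft R (ι R (b i))) (g := 0) (b.ExteriorAlgebra.ext fun K => ?_)
  simp only [LinearMap.comp_apply, LinearMap.mulLeft_apply, LinearMap.zero_apply]
  by_cases hK : i ∈ K
  · rw [ι_mul_basis_of_mem b hK, map_zero, map_zero]
  · rw [interiorProd_ι_mul, interiorProd_basis_of_notMem b hK, mul_zero, sub_zero, b.coord_apply,
      b.repr_self, Finsupp.single_eq_same, one_smul, Module.Basis.coord_apply,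
      Module.Basis.repr_self, Finsupp.single_eq_of_ne (ne_of_mem_of_not_mem' hi hK)]

lemma mem_span_basis_of_interiorProd_eq_zero {m : ℕ} {x : ExteriorAlgebra R M}
    (hx : x ∈ ⋀[R]^m M) {S : Finset κ} (h : ∀ j ∉ S, interiorProd (b.coord j) x = 0) :
    x ∈ Submodule.span R (b.ExteriorAlgebra '' S.powersetCard m) := by
  refine b.ExteriorAlgebra.mem_span_image.2 fun I hI => ?_
  have hrepr : b.ExteriorAlgebra.repr x I ≠ 0 := Finsupp.mem_support_iff.1 hI
  refine Finset.mem_coe.2 (Finset.mem_powersetCard.2 ⟨fun j hj => ?_, ?_⟩)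
  · by_contra hjS
    exact hrepr (repr_eq_zero_of_interiorProd_eq_zero b (h j hjS) hj)
  · by_contra hcard
    exact hrepr (repr_eq_zero_of_mem_exteriorPower b hx hcard)

end Basis

end ExteriorAlgebra

section Contraction

open ExteriorAlgebra

variable {O : Type*} [CommRing O] {n : ℕ}

variable (O) in
/-- The coordinate vector field `∂/∂x_i`. -/
abbrev pd (i : Fin n) : VField O n := Pi.single i 1

/-- The interior product `i_X` of differential forms with the vector field `X`. -/
abbrev interiorVec (X : VField O n) : DForm O n →ₗ[O] DForm O n :=
  interiorProd (Module.Dual.eval O (VField O n) X)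

lemma dx_pd (i j : Fin n) : dx O i (pd O j) = if i = j then 1 else 0 := by
  simp [dx, pd, Pi.single_apply]

lemma basisFun_coord (i : Fin n) : (Pi.basisFun O (Fin n)).coord i = dx O i := by
  ext j
  simp [dx]

lemma basisFun_eq_pd (i : Fin n) : Pi.basisFun O (Fin n) i = pd O i :=
  Pi.basisFun_apply O (Fin n) i

lemma dualBasis_basisFun (i : Fin n) : (Pi.basisFun O (Fin n)).dualBasis i = dx O i := by
  rw [← basisFun_coord, Module.Basis.coe_dualBasis]

lemma dualBasis_basisFun_coord (i : Fin n) :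
    (Pi.basisFun O (Fin n)).dualBasis.coord i = Module.Dual.eval O (VField O n) (pd O i) := by
  refine LinearMap.ext fun α => ?_
  simp [pd]

lemma dual_eq_sum_dx (α : Module.Dual O (VField O n)) : α = ∑ i, α (pd O i) • dx O i := by
  refine (Pi.basisFun O (Fin n)).ext fun j => ?_
  simp [dx, Pi.single_apply]

lemma interiorVec_ι_mul (X : VField O n) (α : Module.Dual O (VField O n)) (ω : DForm O n) :
    interiorVec X (ι O α * ω) = α X • ω - ι O α * interiorVec X ω :=
  interiorProd_ι_mul _ _ _

lemma contractMulti_ι (X : VField O n) : contractMulti O n (ι O X) = interiorVec X := by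
  rw [contractMulti, lift_ι_apply]
  rfl

lemma contractMulti_mul (A B : MultiVec O n) (ω : DForm O n) :
    contractMulti O n (A * B) ω = contractMulti O n A (contractMulti O n B ω) := by
  rw [map_mul, Module.End.mul_apply]

lemma contractMulti_ι_mul (X : VField O n) (A : MultiVec O n) (ω : DForm O n) :
    contractMulti O n (ι O X * A) ω = interiorVec X (contractMulti O n A ω) := by
  rw [contractMulti_mul, contractMulti_ι]

lemma contractMulti_algebraMap (c : O) (ω : DForm O n) :
    contractMulti O n (algebraMap O _ c) ω = c • ω := by
  rw [AlgHom.commutes, Module.algebraMap_end_apply]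

lemma contractMulti_coeff_smul (c : O) (A : MultiVec O n) (ω : DForm O n) :
    contractMulti O n (c • A) ω = c • contractMulti O n A ω := by
  rw [map_smul, LinearMap.smul_apply]

lemma contractMulti_units_smul (ε : ℤˣ) (A : MultiVec O n) (ω : DForm O n) :
    contractMulti O n (ε • A) ω = ε • contractMulti O n A ω :=
  LinearMap.congr_fun (map_zsmul (contractMulti O n) (ε : ℤ) A) ω

lemma contractMulti_mem {a : ℕ} {A : MultiVec O n} (hA : A ∈ ⋀[O]^a (VField O n)) {m : ℕ}
    {ω : DForm O n} (hω : ω ∈ ⋀[O]^(m + a) (Module.Dual O (VField O n))) :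
    contractMulti O n A ω ∈ ⋀[O]^m (Module.Dual O (VField O n)) := by
  refine exteriorPower_induction (C := fun a A => ∀ (m : ℕ) (ω : DForm O n),
    ω ∈ ⋀[O]^(m + a) (Module.Dual O (VField O n)) →
    contractMulti O n A ω ∈ ⋀[O]^m (Module.Dual O (VField O n))) ?_ ?_ ?_ hA m ω hω
  · intro r m ω hω
    rw [contractMulti_algebraMap]
    exact Submodule.smul_mem _ _ hω
  · intro a A B hA hB m ω hω
    rw [map_add, LinearMap.add_apply]
    exact add_mem (hA m ω hω) (hB m ω hω)
  · intro a A X _ hA m ω hω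
    rw [contractMulti_ι_mul]
    exact interiorProd_mem _ (hA (m + 1) ω (by rwa [add_assoc, add_comm 1 a]))

lemma ι_mul_contractMulti {α : Module.Dual O (VField O n)} {ω : DForm O n} (hω : ι O α * ω = 0)
    (A : MultiVec O n) :
    ι O α * contractMulti O n A ω = contractMulti O n (interiorProd α A) ω := by
  refine exteriorAlgebra_induction (C := fun A => ι O α * contractMulti O n A ω =
    contractMulti O n (interiorProd α A) ω) (fun r => ?_) ?_ ?_ A
  · rw [contractMulti_algebraMap, interiorProd_algebraMap, map_zero, LinearMap.zero_apply,
      mul_smul_comm, hω, smul_zero]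
  · intro A B hA hB
    rw [map_add, LinearMap.add_apply, mul_add, hA, hB, map_add, map_add, LinearMap.add_apply]
  · intro A X hA
    have h_antiderivation := interiorVec_ι_mul X α (contractMulti O n A ω)
    rw [hA] at h_antiderivation
    rw [contractMulti_ι_mul, interiorProd_ι_mul, map_sub, LinearMap.sub_apply,
      contractMulti_ι_mul, contractMulti_coeff_smul, h_antiderivation, sub_sub_cancel]

lemma exists_contractMulti_basis {J K : Finset (Fin n)} (hJK : J ⊆ K) :
    ∃ ε : ℤˣ, contractMulti O n (multiVecBasis O n J) (formBasis O n K) =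
      ε • formBasis O n (K \ J) := by
  induction J using Finset.induction with
  | empty => exact ⟨1, by rw [multiVecBasis, basis_empty, map_one, Module.End.one_apply,
      Finset.sdiff_empty, one_smul]⟩
  | insert i J hi ih =>
    obtain ⟨ε, hε⟩ := exists_basis_insert (Pi.basisFun O (Fin n)) hi
    obtain ⟨ε₁, hε₁⟩ := ih ((Finset.subset_insert i J).trans hJK)
    obtain ⟨ε₂, hε₂⟩ := exists_interiorProd_basis_of_mem (Pi.basisFun O (Fin n)).dualBasis
      (Finset.mem_sdiff.2 ⟨hJK (Finset.mem_insert_self i J), hi⟩)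
    rw [dualBasis_basisFun_coord] at hε₂
    refine ⟨ε * (ε₁ * ε₂), ?_⟩
    rw [multiVecBasis, hε, contractMulti_units_smul, basisFun_eq_pd, contractMulti_ι_mul,
      ← multiVecBasis, hε₁, LinearMap.map_smul_of_tower, formBasis, hε₂, mul_smul, mul_smul,
      Finset.sdiff_insert]

variable (O n) in
/-- The form `dx_1 ∧ … ∧ dx_n`. -/
abbrev stdVolume : DForm O n := ιMulti O n (dx O)

lemma stdVolume_mem : stdVolume O n ∈ ⋀[O]^n (Module.Dual O (VField O n)) := ιMulti_mem _

lemma exists_stdVolume_eq_basis : ∃ ε : ℤˣ, stdVolume O n = ε • formBasis O n Finset.univ := by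
  obtain ⟨ε, hε⟩ := exists_ιMulti_comp_basis (Pi.basisFun O (Fin n)).dualBasis
    (Function.injective_id (α := Fin n))
  refine ⟨ε, ?_⟩
  rw [Finset.image_id] at hε
  rw [formBasis, ← hε]
  exact congrArg (ιMulti O n) (funext fun i => (dualBasis_basisFun i).symm)

lemma ι_mul_stdVolume (α : Module.Dual O (VField O n)) : ι O α * stdVolume O n = 0 := by
  rw [dual_eq_sum_dx α, map_sum, Finset.sum_mul]
  refine Finset.sum_eq_zero fun i _ => ?_
  rw [map_smul, smul_mul_assoc, ι_mul_ιMulti_eq_zero, smul_zero]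

lemma ι_mul_contract_stdVolume (α : Module.Dual O (VField O n)) (A : MultiVec O n) :
    ι O α * contractMulti O n A (stdVolume O n) =
      contractMulti O n (interiorProd α A) (stdVolume O n) :=
  ι_mul_contractMulti (ι_mul_stdVolume α) A

lemma exists_contract_stdVolume_basis (J : Finset (Fin n)) :
    ∃ ε : ℤˣ, contractMulti O n (multiVecBasis O n J) (stdVolume O n) = ε • formBasis O n Jᶜ := by
  obtain ⟨ε, hε⟩ := exists_stdVolume_eq_basis (O := O) (n := n)
  obtain ⟨ε', hε'⟩ := exists_contractMulti_basis (O := O) (Finset.subset_univ J)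
  exact ⟨ε * ε', by rw [hε, LinearMap.map_smul_of_tower, hε', mul_smul, Finset.compl_eq_univ_sdiff]⟩

lemma contract_stdVolume_injective :
    Function.Injective fun P => contractMulti O n P (stdVolume O n) := by
  choose ε hε using exists_contract_stdVolume_basis (O := O) (n := n)
  have h_indep : LinearIndependent O fun J => ε J • formBasis O n Jᶜ :=
    ((formBasis O n).linearIndependent.comp _ compl_injective).group_smul ε
  have h_eq : (LinearMap.applyₗ (stdVolume O n) ∘ₗ (contractMulti O n).toLinearMap) ∘
      multiVecBasis O n = fun J => ε J • formBasis O n Jᶜ := funext hε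
  exact LinearMap.injective_of_linearIndependent (multiVecBasis O n).span_eq (h_eq ▸ h_indep)

lemma contract_stdVolume_eq_zero_iff {P : MultiVec O n} :
    contractMulti O n P (stdVolume O n) = 0 ↔ P = 0 := by
  refine ⟨fun h => contract_stdVolume_injective ?_, fun h => ?_⟩
  · simpa only [map_zero, LinearMap.zero_apply] using h
  · rw [h, map_zero, LinearMap.zero_apply]

/-- The derivation of the algebra of multivector fields that extends the infinitesimal linear
transformation `∑ α_k ⊗ ∂/∂x_k` of the vector fields. -/
def linAct (α : Fin n → Module.Dual O (VField O n)) : MultiVec O n →ₗ[O] MultiVec O n :=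
  ∑ k, LinearMap.mulLeft O (ι O (pd O k)) ∘ₗ interiorProd (α k)

/-- The derivation of the algebra of forms that extends the transpose of `∑ α_k ⊗ ∂/∂x_k`. -/
def linActForm (α : Fin n → Module.Dual O (VField O n)) : DForm O n →ₗ[O] DForm O n :=
  ∑ k, LinearMap.mulLeft O (ι O (α k)) ∘ₗ interiorVec (pd O k)

lemma linAct_apply (α : Fin n → Module.Dual O (VField O n)) (A : MultiVec O n) :
    linAct α A = ∑ k, ι O (pd O k) * interiorProd (α k) A := by
  simp [linAct]

lemma linActForm_apply (α : Fin n → Module.Dual O (VField O n)) (ω : DForm O n) :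
    linActForm α ω = ∑ k, ι O (α k) * interiorVec (pd O k) ω := by
  simp [linActForm]

lemma linAct_add (α β : Fin n → Module.Dual O (VField O n)) (A : MultiVec O n) :
    linAct (α + β) A = linAct α A + linAct β A := by
  simp [linAct_apply, mul_add, Finset.sum_add_distrib]

lemma linAct_ι_mul (α : Fin n → Module.Dual O (VField O n)) (X : VField O n)
    (A : MultiVec O n) :
    linAct α (ι O X * A) = ι O X * linAct α A + ∑ k, α k X • (ι O (pd O k) * A) := by
  simp only [linAct_apply, interiorProd_ι_mul, Finset.mul_sum, ← Finset.sum_add_distrib]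
  refine Finset.sum_congr rfl fun k _ => ?_
  rw [mul_sub, ι_mul_ι_mul_swap, sub_neg_eq_add, mul_smul_comm, add_comm]

lemma linAct_algebraMap (α : Fin n → Module.Dual O (VField O n)) (r : O) :
    linAct α (algebraMap O (MultiVec O n) r) = 0 := by
  simp only [linAct_apply, interiorProd_algebraMap, mul_zero, Finset.sum_const_zero]

lemma linAct_mem (α : Fin n → Module.Dual O (VField O n)) {m : ℕ} {A : MultiVec O n}
    (hA : A ∈ ⋀[O]^m (VField O n)) : linAct α A ∈ ⋀[O]^m (VField O n) := by
  refine exteriorPower_induction (C := fun m A => linAct α A ∈ ⋀[O]^m (VField O n))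
    (fun r => ?_) (fun m A B hA hB => ?_) (fun m A X hA ih => ?_) hA
  · rw [linAct_algebraMap]
    exact zero_mem _
  · rw [map_add]
    exact add_mem hA hB
  · rw [linAct_ι_mul]
    exact add_mem (ι_mul_mem X ih)
      (sum_mem fun k _ => Submodule.smul_mem _ _ (ι_mul_mem (pd O k) hA))

lemma linActForm_mul (α : Fin n → Module.Dual O (VField O n)) (ω η : DForm O n) :
    linActForm α (ω * η) = linActForm α ω * η + ω * linActForm α η := by
  simp only [linActForm_apply, Finset.sum_mul, Finset.mul_sum, ← Finset.sum_add_distrib]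
  exact Finset.sum_congr rfl fun k _ => ι_mul_interiorProd_mul _ _ _ _

lemma interiorVec_linActForm (α : Fin n → Module.Dual O (VField O n)) (X : VField O n)
    (ω : DForm O n) :
    interiorVec X (linActForm α ω) =
      linActForm α (interiorVec X ω) + ∑ k, α k X • interiorVec (pd O k) ω := by
  simp only [linActForm_apply, map_sum, interiorVec_ι_mul, ← Finset.sum_add_distrib]
  refine Finset.sum_congr rfl fun k _ => ?_
  rw [interiorProd_comm (Module.Dual.eval O (VField O n) X), mul_neg, sub_neg_eq_add, add_comm]

lemma contractMulti_linActForm (α : Fin n → Module.Dual O (VField O n)) (A : MultiVec O n)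
    (ω : DForm O n) :
    contractMulti O n A (linActForm α ω) =
      linActForm α (contractMulti O n A ω) + contractMulti O n (linAct α A) ω := by
  refine exteriorAlgebra_induction (C := fun A => contractMulti O n A (linActForm α ω) =
      linActForm α (contractMulti O n A ω) + contractMulti O n (linAct α A) ω)
    (fun r => ?_) ?_ ?_ A
  · rw [contractMulti_algebraMap, contractMulti_algebraMap, map_smul, linAct_algebraMap,
      map_zero, LinearMap.zero_apply, add_zero]
  · intro A B hA hB
    simp only [map_add, LinearMap.add_apply, hA, hB]
    abel
  · intro A X hA
    rw [contractMulti_ι_mul, hA, map_add, interiorVec_linActForm, contractMulti_ι_mul,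
      linAct_ι_mul, map_add, LinearMap.add_apply, contractMulti_ι_mul, map_sum,
      LinearMap.sum_apply]
    simp only [contractMulti_coeff_smul, contractMulti_ι_mul]
    abel

/-- The trace of the linear transformation `∑ α_k ⊗ ∂/∂x_k`. -/
def linTrace (α : Fin n → Module.Dual O (VField O n)) : O := ∑ k, α k (pd O k)

lemma linActForm_stdVolume (α : Fin n → Module.Dual O (VField O n)) :
    linActForm α (stdVolume O n) = linTrace α • stdVolume O n := by
  rw [linActForm_apply, linTrace, Finset.sum_smul]
  exact Finset.sum_congr rfl fun k _ =>
    ι_mul_interiorProd_of_ι_mul_eq_zero _ (ι_mul_stdVolume (α k))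

lemma contract_linAct_stdVolume (α : Fin n → Module.Dual O (VField O n)) (A : MultiVec O n) :
    contractMulti O n (linAct α A) (stdVolume O n) =
      linTrace α • contractMulti O n A (stdVolume O n) -
        linActForm α (contractMulti O n A (stdVolume O n)) := by
  rw [eq_sub_iff_add_eq', ← contractMulti_linActForm, linActForm_stdVolume, map_smul]

end Contraction

section ConstantNambu

open ExteriorAlgebra

variable {O : Type*} [CommRing O] {n q : ℕ}

/-- The indices of the coordinates `x_1, …, x_q` along the leaves of
`∂/∂x_1 ∧ … ∧ ∂/∂x_q`. The other coordinates are constant along the leaves. -/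
def leafIndices (n q : ℕ) : Finset (Fin n) := {i | (i : ℕ) < q}

variable (hqn : q ≤ n)

lemma image_castLE : Finset.univ.image (Fin.castLE hqn) = leafIndices n q := by
  ext i
  simp only [Finset.mem_image, Finset.mem_univ, true_and, leafIndices, Finset.mem_filter]
  exact ⟨by rintro ⟨k, rfl⟩; exact k.2, fun h => ⟨⟨i, h⟩, rfl⟩⟩

include hqn in
lemma card_leafIndices : (leafIndices n q).card = q := by
  rw [← image_castLE hqn, Finset.card_image_of_injective _ (Fin.castLE_injective hqn),
    Finset.card_univ, Fintype.card_fin]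

lemma constantNambu_mem : constantNambu O hqn ∈ ⋀[O]^q (VField O n) := ιMulti_mem _

lemma exists_constantNambu_eq_basis :
    ∃ ε : ℤˣ, constantNambu O hqn = ε • multiVecBasis O n (leafIndices n q) := by
  obtain ⟨ε, hε⟩ := exists_ιMulti_comp_basis (Pi.basisFun O (Fin n)) (Fin.castLE_injective hqn)
  rw [image_castLE] at hε
  refine ⟨ε, ?_⟩
  rw [multiVecBasis, ← hε]
  exact congrArg (ιMulti O q) (funext fun i => (basisFun_eq_pd _).symm)

lemma exists_basis_eq_constantNambu :
    ∃ ε : ℤˣ, multiVecBasis O n (leafIndices n q) = ε • constantNambu O hqn := by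
  obtain ⟨ε, hε⟩ := exists_constantNambu_eq_basis (O := O) hqn
  exact ⟨ε, by rw [hε, smul_smul, Int.units_mul_self, one_smul]⟩

lemma smul_constantNambu_eq_zero_iff {c : O} : c • constantNambu O hqn = 0 ↔ c = 0 := by
  obtain ⟨ε, hε⟩ := exists_constantNambu_eq_basis (O := O) hqn
  rw [hε, smul_comm, smul_eq_zero_iff_eq]
  refine ⟨fun h => ?_, fun h => by rw [h, zero_smul]⟩
  have h_repr := congrArg (fun A => (multiVecBasis O n).repr A (leafIndices n q)) h
  simpa using h_repr

lemma pd_mul_constantNambu {i : Fin n} (hi : i ∈ leafIndices n q) :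
    ι O (pd O i) * constantNambu O hqn = 0 := by
  rw [← image_castLE hqn] at hi
  obtain ⟨k, -, rfl⟩ := Finset.mem_image.1 hi
  exact ι_mul_ιMulti_eq_zero (fun k : Fin q => pd O (Fin.castLE hqn k)) k

lemma pd_mul_interiorProd_constantNambu (α : Module.Dual O (VField O n)) {i : Fin n}
    (hi : i ∈ leafIndices n q) :
    ι O (pd O i) * interiorProd α (constantNambu O hqn) = α (pd O i) • constantNambu O hqn :=
  ι_mul_interiorProd_of_ι_mul_eq_zero α (pd_mul_constantNambu hqn hi)

lemma pd_mul_pd_mul_interiorProd_interiorProd (α β : Module.Dual O (VField O n)) {i j : Fin n}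
    (hi : i ∈ leafIndices n q) (hj : j ∈ leafIndices n q) :
    ι O (pd O j) * (ι O (pd O i) * interiorProd α (interiorProd β (constantNambu O hqn))) =
      (α (pd O i) * β (pd O j) - α (pd O j) * β (pd O i)) • constantNambu O hqn := by
  have h_antiderivation := interiorProd_ι_mul α (pd O i) (interiorProd β (constantNambu O hqn))
  rw [pd_mul_interiorProd_constantNambu hqn β hi, map_smul, eq_sub_iff_add_eq',
    ← eq_sub_iff_add_eq] at h_antiderivation
  rw [h_antiderivation, mul_sub, mul_smul_comm, mul_smul_comm,
    pd_mul_interiorProd_constantNambu hqn β hj, pd_mul_interiorProd_constantNambu hqn α hj,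
    smul_smul, smul_smul, ← sub_smul, mul_comm (β (pd O i))]

lemma interiorProd_constantNambu {α : Module.Dual O (VField O n)}
    (h : ∀ i ∈ leafIndices n q, α (pd O i) = 0) : interiorProd α (constantNambu O hqn) = 0 :=
  interiorProd_ιMulti_eq_zero _ _ fun k =>
    h _ (image_castLE hqn ▸ Finset.mem_image_of_mem _ (Finset.mem_univ k))

lemma interiorProd_dx_constantNambu {j : Fin n} (hj : j ∉ leafIndices n q) :
    interiorProd (dx O j) (constantNambu O hqn) = 0 :=
  interiorProd_constantNambu hqn fun i hi => by
    rw [dx_pd, if_neg (ne_of_mem_of_not_mem hi hj).symm]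

/-- The form `i_Λ (dx_1 ∧ … ∧ dx_n)` for `Λ = ∂/∂x_1 ∧ … ∧ ∂/∂x_q`, that is,
`dx_{q+1} ∧ … ∧ dx_n` up to sign. -/
abbrev constantForm : DForm O n := contractMulti O n (constantNambu O hqn) (stdVolume O n)

include hqn in
lemma contract_stdVolume_mem {P : MultiVec O n} (hP : P ∈ ⋀[O]^q (VField O n)) :
    contractMulti O n P (stdVolume O n) ∈ ⋀[O]^(n - q) (Module.Dual O (VField O n)) :=
  contractMulti_mem hP (by rw [Nat.sub_add_cancel hqn]; exact stdVolume_mem)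

lemma constantForm_mem : constantForm hqn ∈ ⋀[O]^(n - q) (Module.Dual O (VField O n)) :=
  contract_stdVolume_mem hqn (constantNambu_mem hqn)

lemma exists_constantForm_eq_basis :
    ∃ ε : ℤˣ, constantForm hqn = ε • formBasis O n (leafIndices n q)ᶜ := by
  obtain ⟨ε, hε⟩ := exists_constantNambu_eq_basis (O := O) hqn
  obtain ⟨ε', hε'⟩ := exists_contract_stdVolume_basis (O := O) (leafIndices n q)
  exact ⟨ε * ε', by rw [constantForm, hε, contractMulti_units_smul, hε', mul_smul]⟩

lemma ι_mul_constantForm_eq_zero {α : Module.Dual O (VField O n)}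
    (h : ∀ i ∈ leafIndices n q, α (pd O i) = 0) : ι O α * constantForm hqn = 0 := by
  rw [ι_mul_contract_stdVolume, interiorProd_constantNambu hqn h, map_zero, LinearMap.zero_apply]

lemma dx_mul_constantForm {j : Fin n} (hj : j ∉ leafIndices n q) :
    ι O (dx O j) * constantForm hqn = 0 := by
  rw [ι_mul_contract_stdVolume, interiorProd_dx_constantNambu hqn hj, map_zero,
    LinearMap.zero_apply]

lemma interiorVec_contract_constantForm {s : ℕ} {A : MultiVec O n} (hA : A ∈ ⋀[O]^s (VField O n))
    {i : Fin n} (hi : i ∈ leafIndices n q) :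
    interiorVec (pd O i) (contractMulti O n A (constantForm hqn)) = 0 := by
  have h_swap : ι O (pd O i) * (A * constantNambu O hqn) = 0 := by
    rw [← mul_assoc, ← ((isUnit_neg_one (α := O)).pow s).smul_eq_zero, ← smul_mul_assoc,
      ← mul_ι_of_mem hA,
      mul_assoc, pd_mul_constantNambu hqn hi, mul_zero]
  rw [← contractMulti_mul, ← contractMulti_ι_mul, h_swap, map_zero, LinearMap.zero_apply]

lemma exists_contract_constantForm_eq_ι {s : ℕ} (hs : s + 1 = n - q) {A : MultiVec O n}
    (hA : A ∈ ⋀[O]^s (VField O n)) :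
    ∃ θ : Module.Dual O (VField O n), contractMulti O n A (constantForm hqn) = ι O θ ∧
      ∀ i ∈ leafIndices n q, θ (pd O i) = 0 := by
  have h_mem : contractMulti O n A (constantForm hqn) ∈ ⋀[O]^1 (Module.Dual O (VField O n)) :=
    contractMulti_mem hA (by rw [add_comm, hs]; exact constantForm_mem hqn)
  obtain ⟨θ, hθ⟩ := exists_eq_ι_of_mem h_mem
  refine ⟨θ, hθ, fun i hi => ?_⟩
  have h_interior := interiorVec_ι_mul (pd O i) θ 1
  rw [mul_one, ← hθ, interiorVec_contract_constantForm hqn hA hi, interiorProd_one, mul_zero,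
    sub_zero, ← Algebra.algebraMap_eq_smul_one] at h_interior
  exact (algebraMap_eq_zero_iff _ _).1 h_interior.symm

lemma exists_contract_constantForm_eq_dx {s : ℕ} (hs : s + 1 = n - q) {j : Fin n}
    (hj : j ∉ leafIndices n q) :
    ∃ A ∈ ⋀[O]^s (VField O n), contractMulti O n A (constantForm hqn) = ι O (dx O j) := by
  have h_compl : j ∈ (leafIndices n q)ᶜ := Finset.mem_compl.2 hj
  have h_card : ((leafIndices n q)ᶜ.erase j).card = s := by
    rw [Finset.card_erase_of_mem h_compl, Finset.card_compl, Fintype.card_fin,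
      card_leafIndices hqn, ← hs, Nat.add_sub_cancel]
  obtain ⟨ε, hε⟩ := exists_constantForm_eq_basis (O := O) hqn
  obtain ⟨ε', hε'⟩ := exists_contractMulti_basis (O := O) (Finset.erase_subset j (leafIndices n q)ᶜ)
  rw [Finset.sdiff_erase_self h_compl, formBasis, basis_singleton, dualBasis_basisFun] at hε'
  refine ⟨(ε * ε') • multiVecBasis O n ((leafIndices n q)ᶜ.erase j), ?_, ?_⟩
  · exact zsmul_mem (h_card ▸ basis_mem_exteriorPower _ _) _
  · rw [contractMulti_units_smul, hε, LinearMap.map_smul_of_tower, formBasis, hε', smul_smul,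
      smul_smul, mul_assoc, Int.units_mul_self, one_smul]

lemma constantForm_mul_contract {s : ℕ} (hs : s + 1 = n - q) {A : MultiVec O n}
    (hA : A ∈ ⋀[O]^s (VField O n)) :
    constantForm hqn * contractMulti O n A (constantForm hqn) = 0 := by
  obtain ⟨θ, hθ, h_leaf⟩ := exists_contract_constantForm_eq_ι hqn hs hA
  rw [hθ, mul_ι_eq_zero_iff (constantForm_mem hqn), ι_mul_constantForm_eq_zero hqn h_leaf]

-- Differentiating `ω ∧ i_A ω = 0`, which holds for all `A`, along the linear group action.
lemma linAct_constantNambu_decomposable (α : Fin n → Module.Dual O (VField O n)) {s : ℕ}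
    (hs : s + 1 = n - q) {A : MultiVec O n} (hA : A ∈ ⋀[O]^s (VField O n)) :
    constantForm hqn * contractMulti O n A
        (contractMulti O n (linAct α (constantNambu O hqn)) (stdVolume O n)) +
      contractMulti O n (linAct α (constantNambu O hqn)) (stdVolume O n) *
        contractMulti O n A (constantForm hqn) = 0 := by
  have h_decomposable := constantForm_mul_contract hqn hs hA
  have h_leibniz := linActForm_mul α (constantForm hqn) (contractMulti O n A (constantForm hqn))
  rw [h_decomposable, map_zero] at h_leibniz
  rw [contract_linAct_stdVolume, map_sub, map_smul, contractMulti_linActForm, mul_sub, mul_add,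
    sub_mul, mul_smul_comm, smul_mul_assoc, h_decomposable,
    constantForm_mul_contract hqn hs (linAct_mem α hA)]
  simp only [smul_zero, zero_sub, add_zero]
  rw [← neg_add, add_comm, ← h_leibniz, neg_zero]

lemma interiorProd_interiorProd_eq_zero_of_decomposable {P : MultiVec O n}
    (hP : P ∈ ⋀[O]^q (VField O n))
    (h : ∀ s : ℕ, s + 1 = n - q → ∀ A ∈ ⋀[O]^s (VField O n),
      constantForm hqn * contractMulti O n A (contractMulti O n P (stdVolume O n)) +
        contractMulti O n P (stdVolume O n) * contractMulti O n A (constantForm hqn) = 0)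
    {j k : Fin n} (hj : j ∉ leafIndices n q) (hk : k ∉ leafIndices n q) :
    interiorProd (dx O k) (interiorProd (dx O j) P) = 0 := by
  have h_codim : n - q - 1 + 1 = n - q := by
    simp only [leafIndices, Finset.mem_filter, Finset.mem_univ, true_and] at hj
    omega
  obtain ⟨A, hA, hA_dx⟩ := exists_contract_constantForm_eq_dx (O := O) hqn h_codim hj
  have h_wedge := congrArg (ι O (dx O k) * ·) (h _ h_codim A hA)
  simp only [mul_add, mul_zero, ← mul_assoc] at h_wedge
  rwa [dx_mul_constantForm hqn hk, zero_mul, zero_add, hA_dx,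
    mul_ι_eq_zero_iff (ι_mul_mem _ (contract_stdVolume_mem hqn hP)), ι_mul_contract_stdVolume,
    ι_mul_contract_stdVolume, contract_stdVolume_eq_zero_iff, interiorProd_comm,
    neg_eq_zero] at h_wedge

lemma exists_smul_constantNambu {P : MultiVec O n} (hP : P ∈ ⋀[O]^q (VField O n))
    (h : ∀ j ∉ leafIndices n q, interiorProd (dx O j) P = 0) :
    ∃ f : O, P = f • constantNambu O hqn := by
  have h_span := mem_span_basis_of_interiorProd_eq_zero (Pi.basisFun O (Fin n)) hP
    (fun j hj => by rw [basisFun_coord, h j hj])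
  have h_powerset := Finset.powersetCard_self (leafIndices n q)
  rw [card_leafIndices hqn] at h_powerset
  rw [h_powerset, Finset.coe_singleton, Set.image_singleton] at h_span
  obtain ⟨f, hf⟩ := Submodule.mem_span_singleton.1 h_span
  obtain ⟨ε, hε⟩ := exists_basis_eq_constantNambu (O := O) hqn
  refine ⟨ε • f, ?_⟩
  rw [← hf, ← multiVecBasis, hε, smul_comm, smul_assoc]

lemma exists_interiorProd_constantNambu {m : ℕ} (hm : m + 1 = q) {P : MultiVec O n}
    (hP : P ∈ ⋀[O]^m (VField O n)) (h : ∀ j ∉ leafIndices n q, interiorProd (dx O j) P = 0) :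
    ∃ α : Module.Dual O (VField O n), P = interiorProd α (constantNambu O hqn) := by
  let contractions : Submodule O (MultiVec O n) :=
    LinearMap.range (CliffordAlgebra.contractLeft (Q := 0) |>.flip (constantNambu O hqn))
  suffices h_mem : P ∈ contractions from h_mem.imp fun α hα => hα.symm
  have h_span := mem_span_basis_of_interiorProd_eq_zero (Pi.basisFun O (Fin n)) hP
    (fun j hj => by rw [basisFun_coord, h j hj])
  refine Submodule.span_le.2 ?_ h_span
  rintro _ ⟨I, hI, rfl⟩
  obtain ⟨hI_subset, hI_card⟩ := Finset.mem_powersetCard.1 hI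
  obtain ⟨i, hi, hi_insert⟩ := Finset.exists_eq_insert_iff.2
    ⟨hI_subset, by rw [hI_card, hm, card_leafIndices hqn]⟩
  obtain ⟨ε, hε⟩ := exists_interiorProd_basis_of_mem (Pi.basisFun O (Fin n))
    (hi_insert ▸ Finset.mem_insert_self i I : i ∈ leafIndices n q)
  obtain ⟨ε', hε'⟩ := exists_basis_eq_constantNambu (O := O) hqn
  have h_erase : (leafIndices n q).erase i = I := by rw [← hi_insert, Finset.erase_insert hi]
  have h_basis : (Pi.basisFun O (Fin n)).ExteriorAlgebra I =
      (ε * ε') • interiorProd (dx O i) (constantNambu O hqn) := by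
    rw [h_erase, basisFun_coord, ← multiVecBasis, hε', LinearMap.map_smul_of_tower] at hε
    rw [mul_smul, hε, smul_smul, Int.units_mul_self, one_smul, multiVecBasis]
  rw [h_basis]
  exact zsmul_mem (show interiorProd (dx O i) (constantNambu O hqn) ∈ contractions from
    ⟨dx O i, rfl⟩) _

lemma interiorProd_dx_linAct_constantNambu (α : Fin n → Module.Dual O (VField O n)) {j : Fin n}
    (hj : j ∉ leafIndices n q) :
    interiorProd (dx O j) (linAct α (constantNambu O hqn)) =
      interiorProd (α j) (constantNambu O hqn) := by
  have h_comm : ∀ k, interiorProd (dx O j) (interiorProd (α k) (constantNambu O hqn)) = 0 := by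
    intro k
    rw [interiorProd_comm, interiorProd_dx_constantNambu hqn hj, map_zero, neg_zero]
  simp only [linAct_apply, map_sum, interiorProd_ι_mul, h_comm, dx_pd, mul_zero, sub_zero,
    ite_smul, one_smul, zero_smul, Finset.sum_ite_eq, Finset.mem_univ, if_true]

lemma linAct_single_constantNambu {i : Fin n} (hi : i ∈ leafIndices n q)
    (β : Module.Dual O (VField O n)) :
    linAct (Pi.single i β) (constantNambu O hqn) = β (pd O i) • constantNambu O hqn := by
  rw [linAct_apply, Finset.sum_eq_single i]
  · rw [Pi.single_eq_same, pd_mul_interiorProd_constantNambu hqn β hi]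
  · intro k _ hk
    rw [Pi.single_eq_of_ne hk, interiorProd, map_zero, LinearMap.zero_apply, mul_zero]
  · simp

-- At most one factor transversal to the leaves means tangent to the orbit of `Λ` under the
-- general linear group.
lemma exists_linAct_constantNambu (hq : 1 ≤ q) {P : MultiVec O n}
    (hP : P ∈ ⋀[O]^q (VField O n))
    (h : ∀ j ∉ leafIndices n q, ∀ k ∉ leafIndices n q,
      interiorProd (dx O k) (interiorProd (dx O j) P) = 0) :
    ∃ α : Fin n → Module.Dual O (VField O n), P = linAct α (constantNambu O hqn) := by
  obtain ⟨m, rfl⟩ := Nat.exists_eq_add_of_le' hq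
  choose! α hα using fun j (hj : j ∉ leafIndices n (m + 1)) =>
    exists_interiorProd_constantNambu hqn rfl (interiorProd_mem (dx O j) hP) (h j hj)
  obtain ⟨f, hf⟩ := exists_smul_constantNambu hqn
    (sub_mem hP (linAct_mem α (constantNambu_mem hqn))) fun j hj => by
      rw [map_sub, interiorProd_dx_linAct_constantNambu hqn α hj, hα j hj, sub_self]
  obtain ⟨i, hi⟩ := Finset.card_pos.1 (card_leafIndices hqn ▸ hq)
  refine ⟨Pi.single i (f • dx O i) + α, ?_⟩
  rw [linAct_add, linAct_single_constantNambu hqn hi, LinearMap.smul_apply, dx_pd, if_pos rfl,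
    smul_eq_mul, mul_one, ← hf, sub_add_cancel]

lemma symm_of_sum_dx_dx_constantForm {c : Fin n → Fin n → O}
    (h : ∑ i, ∑ j, c i j • (ι O (dx O i) * (ι O (dx O j) * constantForm hqn)) = 0) {i j : Fin n}
    (hi : i ∈ leafIndices n q) (hj : j ∈ leafIndices n q) : c i j = c j i := by
  have h_interior : ∑ k, ∑ l, c k l • interiorProd (dx O k)
      (interiorProd (dx O l) (constantNambu O hqn)) = 0 := by
    rw [← contract_stdVolume_eq_zero_iff, ← h]
    simp only [map_sum, LinearMap.sum_apply, contractMulti_coeff_smul, ι_mul_contract_stdVolume]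
  have h_wedge := congrArg (fun A => ι O (pd O j) * (ι O (pd O i) * A)) h_interior
  simp only [Finset.mul_sum, mul_smul_comm, pd_mul_pd_mul_interiorProd_interiorProd hqn _ _ hi hj,
    smul_smul, mul_zero, ← Finset.sum_smul, smul_constantNambu_eq_zero_iff] at h_wedge
  simp only [dx_pd, mul_sub, Finset.sum_sub_distrib, mul_ite, mul_one, mul_zero,
    Finset.sum_ite_eq', Finset.mem_univ, if_true] at h_wedge
  exact sub_eq_zero.1 h_wedge

end ConstantNambu

section CoefficientDerivative

variable {𝕜 : Type*} [Field 𝕜] {O : Type*} [CommRing O] [Algebra 𝕜 O] {n : ℕ}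
  {M : Type*} [AddCommGroup M] [Module O M] [Module 𝕜 M] [IsScalarTower 𝕜 O M]
  (b : Module.Basis (Finset (Fin n)) O M) (δ : Derivation 𝕜 O O)

lemma coeffDeriv_apply (m : M) : coeffDeriv b δ m = ∑ I, δ (b.repr m I) • b I := rfl

lemma repr_coeffDeriv (m : M) (I : Finset (Fin n)) :
    b.repr (coeffDeriv b δ m) I = δ (b.repr m I) := by
  rw [coeffDeriv_apply, b.repr_sum_self]

lemma coeffDeriv_smul (f : O) (m : M) :
    coeffDeriv b δ (f • m) = δ f • m + f • coeffDeriv b δ m := by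
  refine b.ext_elem fun I => ?_
  simp only [repr_coeffDeriv, map_add, map_smul, Finsupp.add_apply, Finsupp.smul_apply, smul_eq_mul,
    Derivation.leibniz]
  ring

lemma coeffDeriv_units_smul_basis (ε : ℤˣ) (I : Finset (Fin n)) :
    coeffDeriv b δ (ε • b I) = 0 := by
  refine (map_zsmul (coeffDeriv b δ) (ε : ℤ) (b I)).trans ?_
  suffices h_basis : coeffDeriv b δ (b I) = 0 by rw [h_basis, smul_zero]
  refine b.ext_elem fun K => ?_
  rw [repr_coeffDeriv, b.repr_self, Finsupp.single_apply]
  split_ifs <;> simp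

lemma coeffDeriv_comm {T : M →ₗ[O] M} (hT : ∀ I, coeffDeriv b δ (T (b I)) = 0) (m : M) :
    coeffDeriv b δ (T m) = T (coeffDeriv b δ m) := by
  conv_lhs => rw [← b.sum_repr m]
  simp only [coeffDeriv_apply b δ m, map_sum, map_smul, coeffDeriv_smul, hT, smul_zero, add_zero]

lemma coeffDeriv_coeffDeriv_comm {δ δ' : Derivation 𝕜 O O} (h : ∀ f, δ (δ' f) = δ' (δ f)) (m : M) :
    coeffDeriv b δ (coeffDeriv b δ' m) = coeffDeriv b δ' (coeffDeriv b δ m) := by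
  refine b.ext_elem fun I => ?_
  simp only [repr_coeffDeriv, h]

end CoefficientDerivative

section ExteriorDerivative

open ExteriorAlgebra

variable {𝕜 : Type*} [Field 𝕜] {O : Type*} [CommRing O] [Algebra 𝕜 O] {n : ℕ}
  (D : Fin n → Derivation 𝕜 O O)

lemma coeffDeriv_dx_mul (δ : Derivation 𝕜 O O) (i : Fin n) (w : DForm O n) :
    coeffDeriv (formBasis O n) δ (ι O (dx O i) * w) =
      ι O (dx O i) * coeffDeriv (formBasis O n) δ w := by
  refine coeffDeriv_comm (T := LinearMap.mulLeft O (ι O (dx O i))) _ _ (fun I => ?_) w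
  rw [LinearMap.mulLeft_apply, ← dualBasis_basisFun]
  by_cases hi : i ∈ I
  · rw [formBasis, ι_mul_basis_of_mem _ hi, map_zero]
  · obtain ⟨ε, hε⟩ := exists_ι_mul_basis_of_notMem (Pi.basisFun O (Fin n)).dualBasis hi
    rw [formBasis, hε, coeffDeriv_units_smul_basis]

lemma coeffDeriv_interiorVec_pd (δ : Derivation 𝕜 O O) (i : Fin n) (w : DForm O n) :
    coeffDeriv (formBasis O n) δ (interiorVec (pd O i) w) =
      interiorVec (pd O i) (coeffDeriv (formBasis O n) δ w) := by
  refine coeffDeriv_comm _ _ (fun I => ?_) w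
  rw [interiorVec, ← dualBasis_basisFun_coord]
  by_cases hi : i ∈ I
  · obtain ⟨ε, hε⟩ := exists_interiorProd_basis_of_mem (Pi.basisFun O (Fin n)).dualBasis hi
    rw [formBasis, hε, coeffDeriv_units_smul_basis]
  · rw [formBasis, interiorProd_basis_of_notMem _ hi, map_zero]

/-- The differential of a function. -/
def grad (f : O) : Module.Dual O (VField O n) := ∑ i, D i f • dx O i

lemma grad_pd (f : O) (i : Fin n) : grad D f (pd O i) = D i f := by
  simp [grad, dx_pd]

lemma ι_grad_mul (f : O) (w : DForm O n) :
    ι O (grad D f) * w = ∑ i, D i f • (ι O (dx O i) * w) := by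
  simp only [grad, map_sum, map_smul, Finset.sum_mul, smul_mul_assoc]

lemma extDer_smul_function (f : O) (w : DForm O n) :
    extDer D (f • w) = ι O (grad D f) * w + f • extDer D w := by
  rw [ι_grad_mul]
  simp only [extDer, coeffDeriv_smul, mul_add, mul_smul_comm, Finset.sum_add_distrib,
    Finset.smul_sum]

lemma extDer_sum {κ : Type*} (s : Finset κ) (w : κ → DForm O n) :
    extDer D (∑ k ∈ s, w k) = ∑ k ∈ s, extDer D (w k) := by
  simp only [extDer, map_sum, Finset.mul_sum]
  rw [Finset.sum_comm]

lemma extDer_sub (v w : DForm O n) : extDer D (v - w) = extDer D v - extDer D w := by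
  simp only [extDer, map_sub, mul_sub, Finset.sum_sub_distrib]

lemma dx_mul_extDer (j : Fin n) (w : DForm O n) :
    ι O (dx O j) * extDer D w = -extDer D (ι O (dx O j) * w) := by
  simp only [extDer, Finset.mul_sum, coeffDeriv_dx_mul, ← Finset.sum_neg_distrib]
  exact Finset.sum_congr rfl fun i _ => ι_mul_ι_mul_swap _ _ _

lemma extDer_mem {p : ℕ} {w : DForm O n} (hw : w ∈ ⋀[O]^p (Module.Dual O (VField O n))) :
    extDer D w ∈ ⋀[O]^(p + 1) (Module.Dual O (VField O n)) := by
  refine sum_mem fun i _ => ι_mul_mem _ ?_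
  rw [coeffDeriv_apply]
  refine sum_mem fun I _ => ?_
  by_cases hI : I.card = p
  · exact Submodule.smul_mem _ _ (hI ▸ basis_mem_exteriorPower _ _)
  · rw [formBasis, repr_eq_zero_of_mem_exteriorPower _ hw hI, map_zero, zero_smul]
    exact zero_mem _

lemma sum_sum_eq_zero_of_alternating {κ A : Type*} [Fintype κ] [AddCommGroup A] {a : κ → κ → A}
    (h_self : ∀ i, a i i = 0) (h_swap : ∀ i j, a i j = -a j i) : ∑ i, ∑ j, a i j = 0 := by
  rw [← Finset.sum_product']
  refine Finset.sum_involution (fun x _ => x.swap) (fun x _ => ?_) (fun x _ hx h_fixed => hx ?_)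
    (fun x _ => Finset.mem_univ _) fun x _ => x.swap_swap
  · exact add_eq_zero_iff_eq_neg.2 (h_swap _ _)
  · have h_diag : x.2 = x.1 := congrArg Prod.fst h_fixed
    rw [h_diag, h_self]

variable {D}

lemma extDer_extDer (hD : ∀ i j f, D i (D j f) = D j (D i f)) (w : DForm O n) :
    extDer D (extDer D w) = 0 := by
  simp only [extDer, map_sum, coeffDeriv_dx_mul, Finset.mul_sum]
  refine sum_sum_eq_zero_of_alternating (fun i => ?_) fun i j => ?_
  · rw [← mul_assoc, ι_sq_zero, zero_mul]
  · rw [ι_mul_ι_mul_swap, coeffDeriv_coeffDeriv_comm _ (hD i j)]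

lemma extDer_grad_mul (hD : ∀ i j f, D i (D j f) = D j (D i f)) (f : O) {w : DForm O n}
    (hw : extDer D w = 0) : extDer D (ι O (grad D f) * w) = 0 := by
  have h_leibniz := extDer_smul_function D f w
  rw [hw, smul_zero, add_zero] at h_leibniz
  rw [← h_leibniz, extDer_extDer hD]

/-- The derivation `D i` has primitives that preserve the independence of the other coordinates:
if `D j h = 0` for some `j ≠ i` then `D j H = 0` for the chosen primitive `H` of `h`. -/
def HasCoordPrimitives (D : Fin n → Derivation 𝕜 O O) : Prop :=
  ∀ i h, ∃ H, D i H = h ∧ ∀ j, j ≠ i → D j h = 0 → D j H = 0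

-- Correct a potential for the directions in `S` by a primitive in the new direction `k` of the
-- discrepancy there, which does not depend on the coordinates in `S`.
lemma exists_potential (hD : ∀ i j f, D i (D j f) = D j (D i f)) (hprim : HasCoordPrimitives D)
    {g : Fin n → O} (S : Finset (Fin n)) (hg : ∀ i ∈ S, ∀ j ∈ S, D i (g j) = D j (g i)) :
    ∃ X : O, ∀ i ∈ S, D i X = g i := by
  induction S using Finset.induction with
  | empty => exact ⟨0, by simp⟩
  | insert k S hk ih =>
    obtain ⟨X, hX⟩ := ih fun i hi j hj =>
      hg i (Finset.mem_insert_of_mem hi) j (Finset.mem_insert_of_mem hj)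
    obtain ⟨H, hH, hH_indep⟩ := hprim k (g k - D k X)
    refine ⟨X + H, fun i hi => ?_⟩
    rw [map_add]
    rcases Finset.mem_insert.1 hi with rfl | hiS
    · rw [hH, add_sub_cancel]
    · have h_indep : D i (g k - D k X) = 0 := by
        rw [map_sub, hD i k, hX i hiS, hg i hi k (Finset.mem_insert_self k S), sub_self]
      rw [hX i hiS, hH_indep i (ne_of_mem_of_not_mem hiS hk) h_indep, add_zero]

end ExteriorDerivative

section Rigidity

open ExteriorAlgebra

variable {𝕜 : Type*} [Field 𝕜] {O : Type*} [CommRing O] [Algebra 𝕜 O] {n q : ℕ} (hqn : q ≤ n)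
  (D : Fin n → Derivation 𝕜 O O)

lemma coeffDeriv_constantForm (δ : Derivation 𝕜 O O) :
    coeffDeriv (formBasis O n) δ (constantForm hqn) = 0 := by
  obtain ⟨ε, hε⟩ := exists_constantForm_eq_basis (O := O) hqn
  rw [hε, coeffDeriv_units_smul_basis]

lemma coeffDeriv_constantNambu (δ : Derivation 𝕜 O O) :
    coeffDeriv (multiVecBasis O n) δ (constantNambu O hqn) = 0 := by
  obtain ⟨ε, hε⟩ := exists_constantNambu_eq_basis (O := O) hqn
  rw [hε, coeffDeriv_units_smul_basis]

lemma extDer_constantForm : extDer D (constantForm hqn) = 0 :=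
  Finset.sum_eq_zero fun i _ => by rw [coeffDeriv_constantForm, mul_zero]

lemma extDer_interiorVec_pd_constantForm (k : Fin n) :
    extDer D (interiorVec (pd O k) (constantForm hqn)) = 0 :=
  Finset.sum_eq_zero fun i _ => by
    rw [coeffDeriv_interiorVec_pd, coeffDeriv_constantForm, map_zero, mul_zero]

lemma lieDeriv_constantNambu (X : VField O n) :
    lieDeriv D X (constantNambu O hqn) = -linAct (fun k => grad D (X k)) (constantNambu O hqn) := by
  have h_bracket : ∀ i, ι O (fun k => D i (X k)) = ∑ k, D i (X k) • ι O (pd O k) := fun i => by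
    rw [pi_eq_sum_univ' fun k => D i (X k)]
    simp only [map_sum, map_smul]
  have h_interior : ∀ k, interiorProd (grad D (X k)) (constantNambu O hqn) =
      ∑ i, D i (X k) • interiorProd (dx O i) (constantNambu O hqn) := fun k => by
    simp [grad, interiorProd]
  rw [linAct_apply, lieDeriv]
  simp only [coeffDeriv_constantNambu, smul_zero, zero_sub, h_bracket, h_interior,
    Finset.sum_neg_distrib, Finset.sum_mul, Finset.mul_sum, smul_mul_assoc, mul_smul_comm]
  rw [Finset.sum_comm]
  rfl

variable {D}

lemma extDer_contract_linAct_grad (hD : ∀ i j f, D i (D j f) = D j (D i f)) (X : VField O n) :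
    extDer D (contractMulti O n (linAct (fun k => grad D (X k)) (constantNambu O hqn))
      (stdVolume O n)) = ι O (grad D (linTrace fun k => grad D (X k))) * constantForm hqn := by
  have h_linActForm : extDer D (linActForm (fun k => grad D (X k)) (constantForm hqn)) = 0 := by
    rw [linActForm_apply, extDer_sum]
    exact Finset.sum_eq_zero fun k _ =>
      extDer_grad_mul hD _ (extDer_interiorVec_pd_constantForm hqn D k)
  rw [contract_linAct_stdVolume, extDer_sub, h_linActForm, sub_zero, extDer_smul_function,
    extDer_constantForm, smul_zero, add_zero]

lemma symm_of_extDer_ι_mul_constantForm {α : Module.Dual O (VField O n)}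
    (h : extDer D (ι O α * constantForm hqn) = 0) {i j : Fin n}
    (hi : i ∈ leafIndices n q) (hj : j ∈ leafIndices n q) :
    D i (α (pd O j)) = D j (α (pd O i)) := by
  refine symm_of_sum_dx_dx_constantForm hqn (c := fun l k => D l (α (pd O k))) ?_ hi hj
  have h_dx : ∀ k, extDer D (ι O (dx O k) * constantForm hqn) = 0 := fun k => by
    rw [← neg_eq_zero, ← dx_mul_extDer, extDer_constantForm, mul_zero]
  rw [← h, Finset.sum_comm]
  conv_rhs => rw [dual_eq_sum_dx α]
  simp only [map_sum, map_smul, Finset.sum_mul, smul_mul_assoc, extDer_sum, extDer_smul_function,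
    h_dx, smul_zero, add_zero, ι_grad_mul]

lemma extDer_contract_interiorProd_dx_eq_zero {P : MultiVec O n} (hP : P ∈ ⋀[O]^q (VField O n))
    (h : ∀ s : ℕ, s + 1 = n - q → ∀ A ∈ ⋀[O]^s (VField O n),
      extDer D (contractMulti O n P (stdVolume O n)) * contractMulti O n A (constantForm hqn) = 0)
    {j : Fin n} (hj : j ∉ leafIndices n q) :
    extDer D (contractMulti O n (interiorProd (dx O j) P) (stdVolume O n)) = 0 := by
  have h_codim : n - q - 1 + 1 = n - q := by
    simp only [leafIndices, Finset.mem_filter, Finset.mem_univ, true_and] at hj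
    omega
  obtain ⟨A, hA, hA_dx⟩ := exists_contract_constantForm_eq_dx (O := O) hqn h_codim hj
  have h_wedge := h _ h_codim A hA
  rwa [hA_dx, mul_ι_eq_zero_iff (extDer_mem D (contract_stdVolume_mem hqn hP)), dx_mul_extDer,
    neg_eq_zero, ι_mul_contract_stdVolume] at h_wedge

lemma smul_decomposable_iff (u : Oˣ) (ω η : DForm O n) (A : MultiVec O n) :
    (u : O) • ω * contractMulti O n A ((u : O) • η) +
        (u : O) • η * contractMulti O n A ((u : O) • ω) = 0 ↔
      ω * contractMulti O n A η + η * contractMulti O n A ω = 0 := by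
  rw [← (u * u).isUnit.smul_eq_zero (x := ω * _ + _)]
  simp only [Units.val_mul, map_smul, smul_mul_assoc, mul_smul_comm, smul_smul, smul_add]

lemma smul_closed_iff (u : Oˣ) {ω η : DForm O n} (hω : extDer D ω = 0) {A : MultiVec O n}
    (h : ω * contractMulti O n A η + η * contractMulti O n A ω = 0) :
    extDer D ((u : O) • ω) * contractMulti O n A ((u : O) • η) +
        extDer D ((u : O) • η) * contractMulti O n A ((u : O) • ω) = 0 ↔
      extDer D η * contractMulti O n A ω = 0 := by
  have h_expand : extDer D ((u : O) • ω) * contractMulti O n A ((u : O) • η) +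
        extDer D ((u : O) • η) * contractMulti O n A ((u : O) • ω) =
      (u : O) • (ι O (grad D (u : O)) *
        (ω * contractMulti O n A η + η * contractMulti O n A ω)) +
      ((u * u : Oˣ) : O) • (extDer D η * contractMulti O n A ω) := by
    simp only [extDer_smul_function, hω, map_smul, smul_zero, add_zero, add_mul, mul_add, smul_add,
      smul_mul_assoc, mul_smul_comm, mul_assoc, smul_smul, Units.val_mul]
    abel
  rw [h_expand, h, mul_zero, smul_zero, zero_add, (u * u).isUnit.smul_eq_zero]

lemma isNambu_constantNambu {Ω : DForm O n} (hΩ : IsVolumeForm Ω) :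
    IsNambu D Ω q (constantNambu O hqn) := by
  obtain ⟨u, rfl⟩ := hΩ
  refine ⟨constantNambu_mem hqn, ?_, fun s hs A hA => ?_⟩
  · rw [map_smul]
    exact Submodule.smul_mem _ _ (constantForm_mem hqn)
  · have h := constantForm_mul_contract hqn hs hA
    rw [map_smul, extDer_smul_function, extDer_constantForm, smul_zero, add_zero, map_smul,
      smul_mul_assoc, mul_smul_comm, mul_smul_comm, mul_assoc, h, mul_zero, smul_zero, smul_zero]
    exact ⟨rfl, rfl⟩

lemma mem_infinitesimalDeformations_iff {Ω : DForm O n} (hΩ : IsVolumeForm Ω) {P : MultiVec O n} :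
    P ∈ infinitesimalDeformations D Ω q (constantNambu O hqn) ↔
      P ∈ ⋀[O]^q (VField O n) ∧ ∀ s : ℕ, s + 1 = n - q → ∀ A ∈ ⋀[O]^s (VField O n),
        constantForm hqn * contractMulti O n A (contractMulti O n P (stdVolume O n)) +
          contractMulti O n P (stdVolume O n) * contractMulti O n A (constantForm hqn) = 0 ∧
        extDer D (contractMulti O n P (stdVolume O n)) *
          contractMulti O n A (constantForm hqn) = 0 := by
  obtain ⟨u, rfl⟩ := hΩ
  change (_ ∧ _ ∧ _) ↔ _
  rw [map_smul, map_smul]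
  refine and_congr_right fun hP => ?_
  rw [and_iff_right (Submodule.smul_mem _ _ (contract_stdVolume_mem hqn hP))]
  refine forall₄_congr fun s hs A hA => ?_
  rw [smul_decomposable_iff]
  exact and_congr_right (smul_closed_iff u (extDer_constantForm hqn D))

lemma trivialDeformations_le (hD : ∀ i j f, D i (D j f) = D j (D i f)) {Ω : DForm O n}
    (hΩ : IsVolumeForm Ω) :
    trivialDeformations D (constantNambu O hqn) ≤
      infinitesimalDeformations D Ω q (constantNambu O hqn) := by
  rintro _ ⟨X, rfl⟩
  rw [lieDeriv_constantNambu]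
  refine neg_mem ((mem_infinitesimalDeformations_iff hqn hΩ).2
    ⟨linAct_mem _ (constantNambu_mem hqn), fun s hs A hA =>
      ⟨linAct_constantNambu_decomposable hqn _ hs hA, ?_⟩⟩)
  rw [extDer_contract_linAct_grad hqn hD, mul_assoc, constantForm_mul_contract hqn hs hA, mul_zero]

lemma linAct_constantNambu_congr {α β : Fin n → Module.Dual O (VField O n)}
    (h : ∀ k, ∀ i ∈ leafIndices n q, (k ∈ leafIndices n q → i = k) →
      α k (pd O i) = β k (pd O i)) :
    linAct α (constantNambu O hqn) = linAct β (constantNambu O hqn) := by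
  rw [linAct_apply, linAct_apply]
  refine Finset.sum_congr rfl fun k _ => ?_
  by_cases hk : k ∈ leafIndices n q
  · rw [pd_mul_interiorProd_constantNambu hqn _ hk, pd_mul_interiorProd_constantNambu hqn _ hk,
      h k k hk fun _ => rfl]
  · have h_sub : interiorProd (α k - β k) (constantNambu O hqn) = 0 :=
      interiorProd_constantNambu hqn fun i hi => by
        rw [LinearMap.sub_apply, h k i hi fun hk' => absurd hk' hk, sub_self]
    rw [interiorProd, map_sub, LinearMap.sub_apply, sub_eq_zero] at h_sub
    rw [h_sub]

lemma linAct_constantNambu_mem_trivialDeformations (hD : ∀ i j f, D i (D j f) = D j (D i f))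
    (hprim : HasCoordPrimitives D) {α : Fin n → Module.Dual O (VField O n)}
    (hα : ∀ k ∉ leafIndices n q, ∀ i ∈ leafIndices n q, ∀ j ∈ leafIndices n q,
      D i (α k (pd O j)) = D j (α k (pd O i))) :
    linAct α (constantNambu O hqn) ∈ trivialDeformations D (constantNambu O hqn) := by
  have h_potential : ∀ k, ∃ X : O, ∀ i ∈ (leafIndices n q).filter fun i =>
      k ∈ leafIndices n q → i = k, D i X = α k (pd O i) := fun k => by
    refine exists_potential hD hprim _ fun i hi j hj => ?_
    rw [Finset.mem_filter] at hi hj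
    by_cases hk : k ∈ leafIndices n q
    · rw [hi.2 hk, hj.2 hk]
    · exact hα k hk i hi.1 j hj.1
  choose X hX using h_potential
  have h_lie : linAct α (constantNambu O hqn) = -lieDeriv D X (constantNambu O hqn) := by
    rw [lieDeriv_constantNambu, neg_neg]
    refine linAct_constantNambu_congr hqn fun k i hi hik => ?_
    rw [grad_pd, hX k i (Finset.mem_filter.2 ⟨hi, hik⟩)]
  rw [h_lie]
  exact neg_mem ⟨X, rfl⟩

lemma infinitesimalDeformations_le (hq : 1 ≤ q) (hD : ∀ i j f, D i (D j f) = D j (D i f))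
    (hprim : HasCoordPrimitives D) {Ω : DForm O n} (hΩ : IsVolumeForm Ω) :
    infinitesimalDeformations D Ω q (constantNambu O hqn) ≤
      trivialDeformations D (constantNambu O hqn) := by
  intro P hP
  obtain ⟨hPq, h_deform⟩ := (mem_infinitesimalDeformations_iff hqn hΩ).1 hP
  obtain ⟨α, rfl⟩ := exists_linAct_constantNambu hqn hq hPq fun j hj k hk =>
    interiorProd_interiorProd_eq_zero_of_decomposable hqn hPq
      (fun s hs A hA => (h_deform s hs A hA).1) hj hk
  refine linAct_constantNambu_mem_trivialDeformations hqn hD hprim fun k hk i hi j hj => ?_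
  refine symm_of_extDer_ι_mul_constantForm hqn ?_ hi hj
  rw [ι_mul_contract_stdVolume, ← interiorProd_dx_linAct_constantNambu hqn α hk]
  exact extDer_contract_interiorProd_dx_eq_zero hqn hPq (fun s hs A hA => (h_deform s hs A hA).2) hk

end Rigidity

section Formal

open MvPowerSeries

variable {𝕜 : Type*} [Field 𝕜] {n : ℕ}

lemma pderiv_comm (i j : Fin n) (f : MvPowerSeries (Fin n) 𝕜) :
    pderiv 𝕜 i (pderiv 𝕜 j f) = pderiv 𝕜 j (pderiv 𝕜 i f) := by
  by_cases hij : i = j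
  · rw [hij]
  ext m
  simp only [coeff_pderiv, Finsupp.add_apply, Finsupp.single_apply, if_neg hij,
    if_neg (Ne.symm hij), add_zero]
  rw [add_right_comm]
  ring

/-- The formal primitive of `h` in the variable `x_i` that has no monomials free of `x_i`. -/
noncomputable def formalPrimitive (i : Fin n) (h : MvPowerSeries (Fin n) 𝕜) :
    MvPowerSeries (Fin n) 𝕜 := fun m =>
  if m i = 0 then 0 else coeff (m - Finsupp.single i 1) h / (m i : 𝕜)

lemma coeff_formalPrimitive (i : Fin n) (h : MvPowerSeries (Fin n) 𝕜) (m : Fin n →₀ ℕ) :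
    coeff m (formalPrimitive i h) =
      if m i = 0 then 0 else coeff (m - Finsupp.single i 1) h / (m i : 𝕜) := rfl

lemma pderiv_formalPrimitive_self [CharZero 𝕜] (i : Fin n) (h : MvPowerSeries (Fin n) 𝕜) :
    pderiv 𝕜 i (formalPrimitive i h) = h := by
  ext m
  have hm : (m i : 𝕜) + 1 ≠ 0 := Nat.cast_add_one_ne_zero (m i)
  simp [coeff_pderiv, coeff_formalPrimitive, hm]

lemma pderiv_formalPrimitive_of_ne {i j : Fin n} (hij : j ≠ i) (h : MvPowerSeries (Fin n) 𝕜) :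
    pderiv 𝕜 j (formalPrimitive i h) = formalPrimitive i (pderiv 𝕜 j h) := by
  ext m
  simp only [coeff_pderiv, coeff_formalPrimitive, Finsupp.add_apply, Finsupp.tsub_apply,
    Finsupp.single_eq_of_ne hij, Finsupp.single_eq_of_ne hij.symm, add_zero, tsub_zero]
  split_ifs with hmi
  · rw [zero_mul]
  · have h_le : Finsupp.single i 1 ≤ m := Finsupp.single_le_iff.2 (Nat.one_le_iff_ne_zero.2 hmi)
    rw [tsub_add_eq_add_tsub h_le, div_mul_eq_mul_div]

lemma hasCoordPrimitives_pderiv [CharZero 𝕜] :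
    HasCoordPrimitives (pderiv 𝕜 : Fin n → Derivation 𝕜 (MvPowerSeries (Fin n) 𝕜) _) :=
  fun i h => ⟨formalPrimitive i h, pderiv_formalPrimitive_self i h, fun j hj hjh => by
    rw [pderiv_formalPrimitive_of_ne hj, hjh]
    ext m
    simp [coeff_formalPrimitive]⟩

end Formal

section ParametricIntegral

open MeasureTheory Set

open scoped ContDiff

variable {𝕜 E F : Type*} [RCLike 𝕜] [NormedAddCommGroup E] [NormedSpace 𝕜 E]
  [NormedAddCommGroup F] [NormedSpace 𝕜 F] [NormedSpace ℝ F]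

lemma hasFDerivAt_intervalIntegral_of_continuousOn [ProperSpace E] {a b : ℝ} {U : Set E}
    (hU : IsOpen U) {f : ℝ → E → F} {f' : ℝ → E → E →L[𝕜] F}
    (hf : ∀ x ∈ U, ContinuousOn (fun t => f t x) (uIcc a b))
    (hf' : ContinuousOn (fun p : ℝ × E => f' p.1 p.2) (uIcc a b ×ˢ U))
    (h_deriv : ∀ t ∈ uIcc a b, ∀ x ∈ U, HasFDerivAt (f t) (f' t x) x) {x₀ : E} (hx₀ : x₀ ∈ U) :
    HasFDerivAt (fun x => ∫ t in a..b, f t x) (∫ t in a..b, f' t x₀) x₀ := by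
  obtain ⟨ε, hε, hεU⟩ := Metric.nhds_basis_closedBall.mem_iff.1 (hU.mem_nhds hx₀)
  obtain ⟨C, hC⟩ := (isCompact_uIcc.prod (isCompact_closedBall x₀ ε)).exists_bound_of_continuousOn
    (hf'.mono (prod_mono_right hεU))
  have hf'_slice : ContinuousOn (fun t => f' t x₀) (uIcc a b) :=
    hf'.comp (Continuous.prodMk_left x₀).continuousOn fun t ht => ⟨ht, hx₀⟩
  have h_sub : uIoc a b ⊆ uIcc a b := uIoc_subset_uIcc
  refine intervalIntegral.hasFDerivAt_integral_of_dominated_of_fderiv_le (bound := fun _ => C)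
    (F := fun x t => f t x) (F' := fun x t => f' t x) (Metric.closedBall_mem_nhds x₀ hε)
    ?_ (hf x₀ hx₀).intervalIntegrable
    ((hf'_slice.mono h_sub).aestronglyMeasurable measurableSet_uIoc)
    (.of_forall fun t ht x hx => hC (t, x) ⟨h_sub ht, hx⟩) intervalIntegrable_const
    (.of_forall fun t ht x hx => h_deriv t (h_sub ht) x (hεU hx))
  filter_upwards [hU.mem_nhds hx₀] with x hx
  exact ((hf x hx).mono h_sub).aestronglyMeasurable measurableSet_uIoc

lemma intervalIntegral_curryLeft [SMulCommClass 𝕜 ℝ F] [CompleteSpace F] {a b : ℝ} {m : ℕ}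
    {p : ℝ → E [×(m + 1)]→L[𝕜] F} (hp : IntervalIntegrable p volume a b) :
    ∫ t in a..b, (p t).curryLeft = (∫ t in a..b, p t).curryLeft :=
  ContinuousLinearMap.intervalIntegral_comp_comm (𝕜 := 𝕜) (E := E [×(m + 1)]→L[𝕜] F)
    (F := E →L[𝕜] E [×m]→L[𝕜] F) (f := p) (continuousMultilinearCurryLeftEquiv 𝕜
      (fun _ : Fin (m + 1) => E) F).toContinuousLinearEquiv.toContinuousLinearMap hp

lemma intervalIntegral_curry0 [SMulCommClass 𝕜 ℝ F] [CompleteSpace F] {a b : ℝ}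
    {p : ℝ → E [×0]→L[𝕜] F} (hp : IntervalIntegrable p volume a b) :
    ∫ t in a..b, (p t).curry0 = (∫ t in a..b, p t).curry0 :=
  ContinuousLinearMap.intervalIntegral_comp_comm (𝕜 := 𝕜) (E := E [×0]→L[𝕜] F) (F := F) (f := p)
    (continuousMultilinearCurryFin0 𝕜 E F).toContinuousLinearEquiv.toContinuousLinearMap hp

lemma contDiffOn_intervalIntegral [ProperSpace E] [SMulCommClass 𝕜 ℝ F] [CompleteSpace F]
    {a b : ℝ} {U : Set E} (hU : IsOpen U) {f : ℝ → E → F}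
    {p : ℝ → E → FormalMultilinearSeries 𝕜 E F}
    (hp : ∀ t ∈ uIcc a b, HasFTaylorSeriesUpToOn ∞ (f t) (p t) U)
    (hp_cont : ∀ m, ContinuousOn (fun y : ℝ × E => p y.1 y.2 m) (uIcc a b ×ˢ U)) :
    ContDiffOn 𝕜 ∞ (fun x => ∫ t in a..b, f t x) U := by
  have hp_slice : ∀ x ∈ U, ∀ m, ContinuousOn (fun t => p t x m) (uIcc a b) := fun x hx m =>
    (hp_cont m).comp (Continuous.prodMk_left x).continuousOn fun t ht => ⟨ht, hx⟩
  have h_deriv : ∀ m, ∀ x ∈ U, HasFDerivAt (fun x => ∫ t in a..b, p t x m)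
      (∫ t in a..b, p t x (m + 1)).curryLeft x := fun m x hx => by
    rw [← intervalIntegral_curryLeft (hp_slice x hx (m + 1)).intervalIntegrable]
    refine hasFDerivAt_intervalIntegral_of_continuousOn hU (f' := fun t x => (p t x _).curryLeft)
      (fun x hx => hp_slice x hx m) ((continuousMultilinearCurryLeftEquiv 𝕜 (fun _ => E)
      F).continuous.comp_continuousOn (hp_cont (m + 1))) (fun t ht x hx => ?_) hx
    exact ((hp t ht).fderivWithin m
      (WithTop.coe_lt_coe.2 (ENat.natCast_lt_top m)) x hx).hasFDerivAt (hU.mem_nhds hx)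
  refine HasFTaylorSeriesUpToOn.contDiffOn (f' := fun x m => ∫ t in a..b, p t x m)
    ⟨fun x hx => ?_, fun m _ x hx => (h_deriv m x hx).hasFDerivWithinAt,
      fun m _ x hx => (h_deriv m x hx).continuousAt.continuousWithinAt⟩
  refine (intervalIntegral_curry0 (hp_slice x hx 0).intervalIntegrable).symm.trans ?_
  exact intervalIntegral.integral_congr fun t ht => (hp t ht).zero_eq x hx

section PowerSeries

variable {α : Type*} [MeasurableSpace α] {μ : Measure α} [IsFiniteMeasure μ]
  {q : α → FormalMultilinearSeries 𝕜 E F} {B : ℕ → ℝ} {ρ : NNReal}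

lemma le_radius_integral [SMulCommClass 𝕜 ℝ F] (hB : Summable B)
    (hq : ∀ᵐ t ∂μ, ∀ m, ‖q t m‖ * (ρ : ℝ) ^ m ≤ B m) :
    (ρ : ENNReal) ≤ FormalMultilinearSeries.radius fun m => ∫ t, q t m ∂μ := by
  obtain ⟨C, hC⟩ := hB.tendsto_atTop_zero.bddAbove_range
  refine FormalMultilinearSeries.le_radius_of_bound _ (C * μ.real univ) fun m => ?_
  calc ‖∫ t, q t m ∂μ‖ * (ρ : ℝ) ^ m = ‖∫ t, (ρ : ℝ) ^ m • q t m ∂μ‖ := by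
        rw [integral_smul, norm_smul, Real.norm_of_nonneg (by positivity), mul_comm]
    _ ≤ C * μ.real univ := norm_integral_le_of_norm_le_const <| hq.mono fun t ht => by
        rw [norm_smul, Real.norm_of_nonneg (by positivity), mul_comm]
        exact (ht m).trans (hC ⟨m, rfl⟩)

-- The common summable majorant `B` lets the integral be exchanged with the sum of the series.
lemma hasFPowerSeriesOnBall_integral [SMulCommClass 𝕜 ℝ F] [CompleteSpace F] {f : α → E → F}
    {x₀ : E} (hρ : 0 < ρ) (hB : Summable B)
    (hq : ∀ᵐ t ∂μ, ∀ m, ‖q t m‖ * (ρ : ℝ) ^ m ≤ B m)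
    (hq_meas : ∀ m, AEStronglyMeasurable (fun t => q t m) μ)
    (h_sum : ∀ᵐ t ∂μ, ∀ y, ‖y‖ < ρ → HasSum (fun m => q t m fun _ => y) (f t (x₀ + y))) :
    HasFPowerSeriesOnBall (fun x => ∫ t, f t x ∂μ) (fun m => ∫ t, q t m ∂μ) x₀ ρ := by
  refine ⟨le_radius_integral hB hq, by exact_mod_cast hρ, fun {y} hy => ?_⟩
  have hy_norm : ‖y‖ < ρ := by simpa using hy
  have hq_int : ∀ m, Integrable (fun t => q t m) μ := fun m => by
    refine Integrable.of_bound (hq_meas m) (B m / (ρ : ℝ) ^ m) (hq.mono fun t ht => ?_)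
    rw [le_div_iff₀ (pow_pos (NNReal.coe_pos.2 hρ) m)]
    exact ht m
  let eval (m : ℕ) := ContinuousMultilinearMap.apply 𝕜 (fun _ : Fin m => E) F fun _ => y
  have h_eval : ∀ m, ∫ t, q t m (fun _ => y) ∂μ = (∫ t, q t m ∂μ) fun _ => y := fun m =>
    (eval m).integral_comp_comm (hq_int m)
  have h_term : ∀ m, ∀ᵐ t ∂μ, ‖q t m fun _ => y‖ ≤ B m := fun m => hq.mono fun t ht => by
    refine ((q t m).le_opNorm _).trans (le_trans ?_ (ht m))
    rw [Finset.prod_const, Finset.card_univ, Fintype.card_fin]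
    gcongr
  have h_summable : Summable fun m => ∫ t, ‖q t m fun _ => y‖ ∂μ := by
    refine .of_nonneg_of_le (fun m => integral_nonneg fun t => norm_nonneg _) (fun m => ?_)
      (hB.mul_right (μ.real univ))
    refine (Real.le_norm_self _).trans (norm_integral_le_of_norm_le_const (C := B m) ?_)
    simpa only [norm_norm] using h_term m
  have h_hasSum : HasSum (fun m => ∫ t, q t m (fun _ => y) ∂μ)
      (∫ t, ∑' m, q t m (fun _ => y) ∂μ) := hasSum_integral_of_summable_integral_norm
    (fun m => (eval m).integrable_comp (hq_int m)) h_summable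
  have h_tsum : ∫ t, ∑' m, q t m (fun _ => y) ∂μ = ∫ t, f t (x₀ + y) ∂μ :=
    integral_congr_ae (h_sum.mono fun t ht => (ht y hy_norm).tsum_eq)
  rw [← h_tsum]
  simpa only [h_eval] using h_hasSum

end PowerSeries

end ParametricIntegral

section CoordPrimitive

open MeasureTheory Set

open scoped ContDiff

variable {𝕜 : Type*} [RCLike 𝕜] {ι : Type*} [DecidableEq ι]

variable (𝕜) in
/-- Multiplication of the coordinate `x i` by the real number `t`, as a continuous linear map. -/
noncomputable def scaleCoord (i : ι) (t : ℝ) : (ι → 𝕜) →L[𝕜] (ι → 𝕜) :=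
  ContinuousLinearMap.id 𝕜 _ +
    ((t : 𝕜) - 1) • (ContinuousLinearMap.proj i).smulRight (Pi.single i (1 : 𝕜))

/-- The set `U` contains with a point the whole segment obtained by shrinking its `i`-th
coordinate to zero. -/
def StableUnderScaling (i : ι) (U : Set (ι → 𝕜)) : Prop :=
  ∀ x ∈ U, ∀ t ∈ Icc (0 : ℝ) 1, scaleCoord 𝕜 i t x ∈ U

/-- The mean of `h` over the segment obtained by shrinking the `i`-th coordinate to zero. -/
noncomputable def scaledMean (i : ι) (h : (ι → 𝕜) → 𝕜) (x : ι → 𝕜) : 𝕜 :=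
  ∫ t in (0 : ℝ)..1, h (scaleCoord 𝕜 i t x)

/-- The primitive of `h` in the `i`-th coordinate which vanishes where `x i = 0`. Over `ℝ` it is
the integral of `h` over the values of this coordinate from `0` to `x i`, rescaled to the unit
interval so that it also makes sense over `ℂ`. -/
noncomputable def coordPrimitive (i : ι) (h : (ι → 𝕜) → 𝕜) (x : ι → 𝕜) : 𝕜 :=
  x i * scaledMean i h x

variable (i : ι)

lemma scaleCoord_apply (t : ℝ) (x : ι → 𝕜) :
    scaleCoord 𝕜 i t x = Function.update x i (t * x i) := by
  ext j
  rcases eq_or_ne j i with rfl | hj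
  · simp [scaleCoord, sub_mul]
  · simp [scaleCoord, hj]

lemma scaleCoord_one (x : ι → 𝕜) : scaleCoord 𝕜 i 1 x = x := by
  simp [scaleCoord_apply]

lemma scaleCoord_single_self (t : ℝ) :
    scaleCoord 𝕜 i t (Pi.single i 1) = (t : 𝕜) • Pi.single i 1 := by
  simp [scaleCoord, sub_smul]

lemma scaleCoord_single_of_ne {j : ι} (hj : j ≠ i) (t : ℝ) :
    scaleCoord 𝕜 i t (Pi.single j 1) = Pi.single j 1 := by
  simp [scaleCoord, hj.symm]

lemma StableUnderScaling.mapsTo {i : ι} {U : Set (ι → 𝕜)} (hUi : StableUnderScaling i U) :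
    MapsTo (fun p : ℝ × (ι → 𝕜) => scaleCoord 𝕜 i p.1 p.2) (uIcc (0 : ℝ) 1 ×ˢ U) U := by
  rw [uIcc_of_le zero_le_one]
  exact fun p hp => hUi p.2 hp.2 p.1 hp.1

lemma continuous_scaleCoord : Continuous (scaleCoord 𝕜 i) :=
  continuous_const.add (Continuous.smul
    (f := fun t : ℝ => (t : 𝕜) - 1) (RCLike.continuous_ofReal.sub continuous_const)
    continuous_const)

lemma continuous_scaleCoord_apply :
    Continuous fun p : ℝ × (ι → 𝕜) => scaleCoord 𝕜 i p.1 p.2 := by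
  simp only [scaleCoord_apply]
  exact continuous_snd.update i ((RCLike.continuous_ofReal.comp continuous_fst).mul
    ((continuous_apply i).comp continuous_snd))

lemma StableUnderScaling.continuousOn_comp {Y : Type*} [TopologicalSpace Y] {i : ι}
    {U : Set (ι → 𝕜)} (hUi : StableUnderScaling i U) {g : (ι → 𝕜) → Y}
    (hg : ContinuousOn g U) {x : ι → 𝕜} (hx : x ∈ U) :
    ContinuousOn (fun t => g (scaleCoord 𝕜 i t x)) (uIcc (0 : ℝ) 1) :=
  hg.comp ((continuous_scaleCoord_apply i).comp (.prodMk_left x)).continuousOn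
    fun _ ht => hUi.mapsTo (mk_mem_prod ht hx)

section Derivative

variable [Finite ι]

variable (𝕜) in
lemma hasDerivAt_ofReal (t : ℝ) : HasDerivAt (fun s : ℝ => (s : 𝕜)) 1 t := by
  simpa using (RCLike.ofRealCLM (K := 𝕜)).hasDerivAt (x := t)

lemma hasDerivAt_scaleCoord_apply (x : ι → 𝕜) (t : ℝ) :
    HasDerivAt (fun s : ℝ => scaleCoord 𝕜 i s x) (x i • Pi.single i (1 : 𝕜)) t := by
  have := Fintype.ofFinite ι
  simpa [scaleCoord] using
    (((hasDerivAt_ofReal 𝕜 t).sub_const 1).smul_const (x i • Pi.single i (1 : 𝕜))).const_add x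

variable {i}

lemma hasDerivAt_comp_scaleCoord {G : (ι → 𝕜) → 𝕜} {x : ι → 𝕜} {t : ℝ}
    (hG : DifferentiableAt 𝕜 G (scaleCoord 𝕜 i t x)) :
    HasDerivAt (fun s : ℝ => G (scaleCoord 𝕜 i s x))
      (x i * fderiv 𝕜 G (scaleCoord 𝕜 i t x) (Pi.single i 1)) t := by
  have := Fintype.ofFinite ι
  refine ((hG.hasFDerivAt.restrictScalars ℝ).comp_hasDerivAt t
    (hasDerivAt_scaleCoord_apply i x t)).congr_deriv ?_
  rw [ContinuousLinearMap.coe_restrictScalars', map_smul, smul_eq_mul]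

lemma integral_mul_comp_scaleCoord {G h : (ι → 𝕜) → 𝕜} {x : ι → 𝕜} {a b : ℝ}
    (hG : ∀ s ∈ uIcc a b, DifferentiableAt 𝕜 G (scaleCoord 𝕜 i s x))
    (hG_deriv : ∀ s ∈ uIcc a b,
      fderiv 𝕜 G (scaleCoord 𝕜 i s x) (Pi.single i 1) = h (scaleCoord 𝕜 i s x))
    (hh : ∀ s ∈ uIcc a b, ContinuousAt h (scaleCoord 𝕜 i s x)) :
    ∫ s in a..b, x i * h (scaleCoord 𝕜 i s x) =
      G (scaleCoord 𝕜 i b x) - G (scaleCoord 𝕜 i a x) := by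
  have h_deriv : ∀ s ∈ uIcc a b, HasDerivAt (fun s => G (scaleCoord 𝕜 i s x))
      (x i * h (scaleCoord 𝕜 i s x)) s := fun s hs => by
    rw [← hG_deriv s hs]
    exact hasDerivAt_comp_scaleCoord (hG s hs)
  refine intervalIntegral.integral_eq_sub_of_hasDerivAt h_deriv
    (continuousOn_const.mul fun s hs => ?_).intervalIntegrable
  exact ContinuousAt.continuousWithinAt (ContinuousAt.comp (g := h) (hh s hs)
    ((continuous_scaleCoord_apply i).comp (.prodMk_left x)).continuousAt)

end Derivative

variable [Fintype ι]

lemma norm_scaleCoord_apply_le {t : ℝ} (ht : t ∈ Icc (0 : ℝ) 1) (x : ι → 𝕜) :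
    ‖scaleCoord 𝕜 i t x‖ ≤ ‖x‖ := by
  refine (pi_norm_le_iff_of_nonneg (norm_nonneg x)).2 fun j => ?_
  rw [scaleCoord_apply]
  rcases eq_or_ne j i with rfl | hj
  · rw [Function.update_self, norm_mul, RCLike.norm_ofReal, abs_of_nonneg ht.1]
    exact (mul_le_of_le_one_left (norm_nonneg _) ht.2).trans (norm_le_pi_norm x j)
  · rw [Function.update_of_ne hj]
    exact norm_le_pi_norm x j

lemma norm_scaleCoord_le {t : ℝ} (ht : t ∈ Icc (0 : ℝ) 1) : ‖scaleCoord 𝕜 i t‖ ≤ 1 :=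
  ContinuousLinearMap.opNorm_le_bound _ zero_le_one fun x => by
    simpa only [one_mul] using norm_scaleCoord_apply_le i ht x

variable {i}

section OpenSet

variable {U : Set (ι → 𝕜)} {h : (ι → 𝕜) → 𝕜} {x : ι → 𝕜}

lemma hasFDerivAt_scaledMean (hU : IsOpen U) (hUi : StableUnderScaling i U)
    (hh : ContDiffOn 𝕜 1 h U) (hx : x ∈ U) :
    HasFDerivAt (scaledMean i h) (∫ t in (0 : ℝ)..1,
      (fderiv 𝕜 h (scaleCoord 𝕜 i t x)).comp (scaleCoord 𝕜 i t)) x := by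
  refine hasFDerivAt_intervalIntegral_of_continuousOn hU
    (f' := fun t x => (fderiv 𝕜 h (scaleCoord 𝕜 i t x)).comp (scaleCoord 𝕜 i t))
    (fun x hx => hUi.continuousOn_comp hh.continuousOn hx) (ContinuousOn.clm_comp ?_ ?_)
    (fun t ht x hx => ?_) hx
  · exact (hh.continuousOn_fderiv_of_isOpen hU le_rfl).comp
      (continuous_scaleCoord_apply i).continuousOn hUi.mapsTo
  · exact ((continuous_scaleCoord i).comp continuous_fst).continuousOn
  · have h_diff : DifferentiableAt 𝕜 h (scaleCoord 𝕜 i t x) :=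
      (hh.differentiableOn one_ne_zero).differentiableAt
        (hU.mem_nhds (hUi.mapsTo (mk_mem_prod ht hx)))
    exact h_diff.hasFDerivAt.comp x (scaleCoord 𝕜 i t).hasFDerivAt

lemma fderiv_coordPrimitive_apply (hU : IsOpen U) (hUi : StableUnderScaling i U)
    (hh : ContDiffOn 𝕜 1 h U) (hx : x ∈ U) (w : ι → 𝕜) :
    fderiv 𝕜 (coordPrimitive i h) x w = w i * scaledMean i h x +
      x i * ∫ t in (0 : ℝ)..1, fderiv 𝕜 h (scaleCoord 𝕜 i t x) (scaleCoord 𝕜 i t w) := by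
  have h_int : IntervalIntegrable
      (fun t => (fderiv 𝕜 h (scaleCoord 𝕜 i t x)).comp (scaleCoord 𝕜 i t)) volume 0 1 :=
    ((hUi.continuousOn_comp (hh.continuousOn_fderiv_of_isOpen hU le_rfl) hx).clm_comp
      (continuous_scaleCoord i).continuousOn).intervalIntegrable
  have h_mul : HasFDerivAt (coordPrimitive i h) _ x :=
    (hasFDerivAt_apply (𝕜 := 𝕜) (F' := fun _ : ι => 𝕜) i x).mul
      (hasFDerivAt_scaledMean hU hUi hh hx)
  rw [h_mul.fderiv]
  simp only [add_apply, smul_apply, ContinuousLinearMap.intervalIntegral_apply h_int,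
    ContinuousLinearMap.comp_apply, ContinuousLinearMap.proj_apply, smul_eq_mul]
  ring

lemma fderiv_coordPrimitive_of_ne {j : ι} (hj : j ≠ i) (hU : IsOpen U)
    (hUi : StableUnderScaling i U) (hh : ContDiffOn 𝕜 1 h U)
    (hh_indep : ∀ y ∈ U, fderiv 𝕜 h y (Pi.single j 1) = 0) (hx : x ∈ U) :
    fderiv 𝕜 (coordPrimitive i h) x (Pi.single j 1) = 0 := by
  rw [fderiv_coordPrimitive_apply hU hUi hh hx, Pi.single_eq_of_ne hj.symm, zero_mul, zero_add,
    intervalIntegral.integral_congr (g := fun _ => 0), intervalIntegral.integral_zero, mul_zero]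
  intro t ht
  simpa only [scaleCoord_single_of_ne i hj] using hh_indep _ (hUi.mapsTo (mk_mem_prod ht hx))

-- The derivative is the integral of `d/dt (t * h (scaleCoord 𝕜 i t x))` over the unit interval.
lemma fderiv_coordPrimitive_self (hU : IsOpen U) (hUi : StableUnderScaling i U)
    (hh : ContDiffOn 𝕜 1 h U) (hx : x ∈ U) :
    fderiv 𝕜 (coordPrimitive i h) x (Pi.single i 1) = h x := by
  let g (t : ℝ) : 𝕜 := h (scaleCoord 𝕜 i t x)
  let g' (t : ℝ) : 𝕜 := x i * fderiv 𝕜 h (scaleCoord 𝕜 i t x) (Pi.single i 1)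
  have h_deriv : ∀ t ∈ uIcc (0 : ℝ) 1,
      HasDerivAt (fun t : ℝ => (t : 𝕜) * g t) (g t + t * g' t) t := fun t ht => by
    have h_diff : DifferentiableAt 𝕜 h (scaleCoord 𝕜 i t x) :=
      (hh.differentiableOn one_ne_zero).differentiableAt
        (hU.mem_nhds (hUi.mapsTo (mk_mem_prod ht hx)))
    exact ((hasDerivAt_ofReal 𝕜 t).mul (hasDerivAt_comp_scaleCoord h_diff)).congr_deriv
      (by rw [one_mul])
  have hg : IntervalIntegrable g volume 0 1 :=
    (hUi.continuousOn_comp hh.continuousOn hx).intervalIntegrable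
  have hg' : IntervalIntegrable (fun t : ℝ => (t : 𝕜) * g' t) volume 0 1 :=
    (RCLike.continuous_ofReal.continuousOn.mul (continuousOn_const.mul
      ((hUi.continuousOn_comp (hh.continuousOn_fderiv_of_isOpen hU le_rfl) hx).clm_apply
        continuousOn_const))).intervalIntegrable
  calc fderiv 𝕜 (coordPrimitive i h) x (Pi.single i 1)
      = (∫ t in (0 : ℝ)..1, g t) + ∫ t in (0 : ℝ)..1, (t : 𝕜) * g' t := by
        rw [fderiv_coordPrimitive_apply hU hUi hh hx, Pi.single_eq_same, one_mul,
          ← intervalIntegral.integral_const_mul]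
        congr 1
        refine intervalIntegral.integral_congr fun t _ => ?_
        simp only [scaleCoord_single_self, map_smul, smul_eq_mul, g']
        ring
    _ = ∫ t in (0 : ℝ)..1, (g t + t * g' t) := (intervalIntegral.integral_add hg hg').symm
    _ = h x := by
        rw [intervalIntegral.integral_eq_sub_of_hasDerivAt h_deriv (hg.add hg')]
        simp [g, scaleCoord_one]

lemma contDiffOn_scaledMean (hU : IsOpen U) (hUi : StableUnderScaling i U)
    (hh : ContDiffOn 𝕜 ∞ h U) : ContDiffOn 𝕜 ∞ (scaledMean i h) U := by
  refine contDiffOn_intervalIntegral hU (p := fun t x m =>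
    (ftaylorSeriesWithin 𝕜 h U (scaleCoord 𝕜 i t x) m).compContinuousLinearMap
      fun _ => scaleCoord 𝕜 i t) (fun t ht => ?_) fun m => ?_
  · exact ((hh.ftaylorSeriesWithin hU.uniqueDiffOn).compContinuousLinearMap
      (scaleCoord 𝕜 i t)).mono fun x hx => hUi.mapsTo (mk_mem_prod ht hx)
  · have h_series : ContinuousOn (fun y : ℝ × (ι → 𝕜) =>
        ftaylorSeriesWithin 𝕜 h U (scaleCoord 𝕜 i y.1 y.2) m) (uIcc 0 1 ×ˢ U) :=
      (hh.continuousOn_iteratedFDerivWithin (mod_cast le_top) hU.uniqueDiffOn).comp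
        (continuous_scaleCoord_apply i).continuousOn hUi.mapsTo
    have h_comp : Continuous fun y : ℝ × (ι → 𝕜) =>
        ContinuousMultilinearMap.compContinuousLinearMapContinuousMultilinear 𝕜
          (fun _ : Fin m => ι → 𝕜) (fun _ => ι → 𝕜) 𝕜 fun _ => scaleCoord 𝕜 i y.1 :=
      (ContinuousMultilinearMap.cont _).comp
        (continuous_pi fun _ => (continuous_scaleCoord i).comp continuous_fst)
    exact h_comp.continuousOn.clm_apply h_series

end OpenSet

end CoordPrimitive

section AnalyticPrimitive

open MeasureTheory Set

variable {𝕜 : Type*} [RCLike 𝕜]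

lemma analyticAt_intervalIntegral_of_local {E F : Type*} [NormedAddCommGroup E] [NormedSpace 𝕜 E]
    [NormedAddCommGroup F] [NormedSpace 𝕜 F] [NormedSpace ℝ F] {f : ℝ → E → F} {a b : ℝ} {x₀ : E}
    (hf : ∀ᶠ x in 𝓝 x₀, ContinuousOn (fun t => f t x) (uIcc a b))
    (h_local : ∀ t₀ ∈ uIcc a b, ∀ᶠ t in 𝓝 t₀, AnalyticAt 𝕜 (fun x => ∫ s in t₀..t, f s x) x₀) :
    AnalyticAt 𝕜 (fun x => ∫ t in a..b, f t x) x₀ := by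
  have h_int : ∀ t₀ ∈ uIcc a b, ∀ t₁ ∈ uIcc a b,
      ∀ᶠ x in 𝓝 x₀, IntervalIntegrable (fun t => f t x) volume t₀ t₁ := fun t₀ h₀ t₁ h₁ =>
    hf.mono fun x hx => (hx.mono (uIcc_subset_uIcc h₀ h₁)).intervalIntegrable
  refine isPreconnected_uIcc.induction₂
    (fun t₀ t₁ => AnalyticAt 𝕜 (fun x => ∫ t in t₀..t₁, f t x) x₀)
    (fun t ht => (h_local t ht).filter_mono nhdsWithin_le_nhds) ?_ ?_ left_mem_uIcc right_mem_uIcc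
  · intro t₀ t₁ t₂ h₀ h₁ h₂ h₀₁ h₁₂
    refine (h₀₁.add h₁₂).congr ?_
    filter_upwards [h_int t₀ h₀ t₁ h₁, h_int t₁ h₁ t₂ h₂] with x hx₀₁ hx₁₂
    exact intervalIntegral.integral_add_adjacent_intervals hx₀₁ hx₁₂
  · intro t₀ t₁ _ _ h₀₁
    exact h₀₁.fun_neg.congr (.of_forall fun x => (intervalIntegral.integral_symm t₀ t₁).symm)

variable {ι : Type*} [Fintype ι] [DecidableEq ι] {i : ι} {h : (ι → 𝕜) → 𝕜}

lemma analyticAt_scaledMean_zero (hh : AnalyticAt 𝕜 h 0) : AnalyticAt 𝕜 (scaledMean i h) 0 := by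
  obtain ⟨P, r, hP⟩ := hh
  obtain ⟨ρ, hρ, hρr⟩ := ENNReal.lt_iff_exists_nnreal_btwn.1 hP.r_pos
  have h_unit : ∀ᵐ t ∂volume.restrict (Ioc (0 : ℝ) 1), t ∈ Icc (0 : ℝ) 1 :=
    (ae_restrict_mem measurableSet_Ioc).mono fun _ ht => Ioc_subset_Icc_self ht
  have h_series := hasFPowerSeriesOnBall_integral (μ := volume.restrict (Ioc (0 : ℝ) 1))
    (f := fun t x => h (scaleCoord 𝕜 i t x)) (x₀ := 0)
    (q := fun t m => (P m).compContinuousLinearMap fun _ => scaleCoord 𝕜 i t)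
    (by exact_mod_cast hρ) (P.summable_norm_mul_pow (hρr.trans_le hP.r_le))
    (h_unit.mono fun t ht m => ?_) (fun m => ?_) (h_unit.mono fun t ht y hy => ?_)
  · exact h_series.analyticAt.congr
      (.of_forall fun x => (intervalIntegral.integral_of_le zero_le_one).symm)
  · gcongr
    refine ((P m).norm_compContinuousLinearMap_le _).trans
      (mul_le_of_le_one_right (norm_nonneg _) ?_)
    exact Finset.prod_le_one (fun _ _ => norm_nonneg _) fun _ _ => norm_scaleCoord_le i ht
  · have h_comp : Continuous fun t : ℝ =>
        ContinuousMultilinearMap.compContinuousLinearMapContinuousMultilinear 𝕜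
          (fun _ : Fin m => ι → 𝕜) (fun _ => ι → 𝕜) 𝕜 fun _ => scaleCoord 𝕜 i t :=
      (ContinuousMultilinearMap.cont _).comp (continuous_pi fun _ => continuous_scaleCoord i)
    exact (h_comp.clm_apply continuous_const).aestronglyMeasurable
  · have hy_mem : scaleCoord 𝕜 i t y ∈ Metric.eball (0 : ι → 𝕜) r := by
      refine mem_eball_zero_iff.2 (lt_of_le_of_lt ?_ hρr)
      exact_mod_cast (norm_scaleCoord_apply_le i ht y).trans hy.le
    simpa using hP.hasSum hy_mem

lemma stableUnderScaling_ball (ε : ℝ) : StableUnderScaling i (Metric.ball (0 : ι → 𝕜) ε) :=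
  fun x hx _ ht => mem_ball_zero_iff.2
    ((norm_scaleCoord_apply_le i ht x).trans_lt (mem_ball_zero_iff.1 hx))

lemma analyticAt_coordPrimitive_zero (hh : AnalyticAt 𝕜 h 0) :
    AnalyticAt 𝕜 (coordPrimitive i h) 0 :=
  ((ContinuousLinearMap.proj (R := 𝕜) (φ := fun _ : ι => 𝕜) i).analyticAt 0).mul
    (analyticAt_scaledMean_zero hh)

lemma eventually_fderiv_coordPrimitive_self (hh : AnalyticAt 𝕜 h 0) :
    ∀ᶠ x in 𝓝 0, fderiv 𝕜 (coordPrimitive i h) x (Pi.single i 1) = h x := by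
  obtain ⟨ε, hε, h_ball⟩ := Metric.eventually_nhds_iff_ball.1 hh.eventually_analyticAt
  filter_upwards [Metric.ball_mem_nhds 0 hε] with x hx
  exact fderiv_coordPrimitive_self Metric.isOpen_ball (stableUnderScaling_ball ε)
    (fun y hy => (h_ball y hy).contDiffAt.contDiffWithinAt) hx

lemma exists_analyticAt_primitive (i : ι) {c : ι → 𝕜} (hh : AnalyticAt 𝕜 h c) :
    ∃ G, AnalyticAt 𝕜 G c ∧ ∀ᶠ x in 𝓝 c, fderiv 𝕜 G x (Pi.single i 1) = h x := by
  have h_shift : AnalyticAt 𝕜 (fun x => h (x + c)) 0 :=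
    AnalyticAt.fun_comp (by rwa [zero_add]) (analyticAt_id.add analyticAt_const)
  refine ⟨fun x => coordPrimitive i (fun x => h (x + c)) (x - c),
    AnalyticAt.fun_comp (by rw [sub_self]; exact analyticAt_coordPrimitive_zero h_shift)
      (analyticAt_id.sub analyticAt_const), ?_⟩
  have h_tendsto : Filter.Tendsto (fun x => x - c) (𝓝 c) (𝓝 0) :=
    tendsto_sub_nhds_zero_iff.2 Filter.tendsto_id
  filter_upwards [h_tendsto.eventually (eventually_fderiv_coordPrimitive_self h_shift)] with x hx
  rw [fderiv_comp_sub, hx, sub_add_cancel]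

-- Near `(t₀, x₀)` the integral is the increment of a local analytic primitive of `h`.
lemma eventually_analyticAt_integral_scaleCoord {x₀ : ι → 𝕜} {t₀ : ℝ}
    (hh : AnalyticAt 𝕜 h (scaleCoord 𝕜 i t₀ x₀)) :
    ∀ᶠ t in 𝓝 t₀, AnalyticAt 𝕜 (fun x => ∫ s in t₀..t, x i * h (scaleCoord 𝕜 i s x)) x₀ := by
  obtain ⟨G, hG, hG_deriv⟩ := exists_analyticAt_primitive i hh
  let good (y : ι → 𝕜) : Prop :=
    AnalyticAt 𝕜 G y ∧ fderiv 𝕜 G y (Pi.single i 1) = h y ∧ AnalyticAt 𝕜 h y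
  have h_good : ∀ᶠ p : ℝ × (ι → 𝕜) in 𝓝 (t₀, x₀), good (scaleCoord 𝕜 i p.1 p.2) :=
    ((continuous_scaleCoord_apply i).tendsto (t₀, x₀)).eventually
      (hG.eventually_analyticAt.and (hG_deriv.and hh.eventually_analyticAt))
  rw [nhds_prod_eq] at h_good
  obtain ⟨near_t₀, h_near_t₀, near_x₀, h_near_x₀, h_good⟩ := Filter.eventually_prod_iff.1 h_good
  obtain ⟨δ, hδ, h_ball⟩ := Metric.eventually_nhds_iff_ball.1 h_near_t₀
  filter_upwards [Metric.ball_mem_nhds t₀ hδ] with t ht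
  have h_segment : ∀ s ∈ uIcc t₀ t, ∀ x, near_x₀ x → good (scaleCoord 𝕜 i s x) := fun s hs x hx =>
    h_good (h_ball s ((convex_ball t₀ δ).ordConnected.uIcc_subset (Metric.mem_ball_self hδ) ht hs))
      hx
  have h_comp : ∀ s ∈ uIcc t₀ t, AnalyticAt 𝕜 (fun x => G (scaleCoord 𝕜 i s x)) x₀ :=
    fun s hs => AnalyticAt.fun_comp (h_segment s hs x₀ h_near_x₀.self_of_nhds).1
      ((scaleCoord 𝕜 i s).analyticAt x₀)
  refine ((h_comp t right_mem_uIcc).fun_sub (h_comp t₀ left_mem_uIcc)).congr ?_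
  filter_upwards [h_near_x₀] with x hx
  exact (integral_mul_comp_scaleCoord (fun s hs => (h_segment s hs x hx).1.differentiableAt)
    (fun s hs => (h_segment s hs x hx).2.1)
    fun s hs => (h_segment s hs x hx).2.2.continuousAt).symm

lemma analyticAt_coordPrimitive {U : Set (ι → 𝕜)} (hU : IsOpen U) (hUi : StableUnderScaling i U)
    (hh : AnalyticOnNhd 𝕜 h U) {x₀ : ι → 𝕜} (hx₀ : x₀ ∈ U) :
    AnalyticAt 𝕜 (coordPrimitive i h) x₀ := by
  have h_integral : AnalyticAt 𝕜 (fun x => ∫ t in (0 : ℝ)..1, x i * h (scaleCoord 𝕜 i t x)) x₀ := by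
    refine analyticAt_intervalIntegral_of_local ?_ fun t₀ ht₀ =>
      eventually_analyticAt_integral_scaleCoord (hh _ (hUi.mapsTo (mk_mem_prod ht₀ hx₀)))
    filter_upwards [hU.mem_nhds hx₀] with x hx
    exact continuousOn_const.mul (hUi.continuousOn_comp hh.continuousOn hx)
  exact h_integral.congr (.of_forall fun x => intervalIntegral.integral_const_mul _ _)

end AnalyticPrimitive

section Germs

open scoped ContDiff

variable {𝕜 : Type*} [RCLike 𝕜] {n : ℕ} {r : Regularity} {S : Set (Fin n → 𝕜)}

lemma natCast_le_order (m : ℕ) (r : Regularity) : (m : ℕ∞ω) ≤ r.order := by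
  cases r
  · exact WithTop.coe_le_coe.2 le_top
  · exact le_top

lemma contDiffOn_coordPrimitive {ι : Type*} [Fintype ι] [DecidableEq ι] {i : ι} {U : Set (ι → 𝕜)}
    (hU : IsOpen U) (hUi : StableUnderScaling i U) {h : (ι → 𝕜) → 𝕜}
    (hh : ContDiffOn 𝕜 r.order h U) : ContDiffOn 𝕜 r.order (coordPrimitive i h) U := by
  cases r with
  | smooth => exact (contDiff_apply 𝕜 𝕜 i).contDiffOn.mul (contDiffOn_scaledMean hU hUi hh)
  | analytic =>
    have hh_analytic : AnalyticOnNhd 𝕜 h U := fun x hx =>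
      (hh.contDiffAt (hU.mem_nhds hx)).analyticAt
    exact fun x hx =>
      (analyticAt_coordPrimitive hU hUi hh_analytic hx).contDiffAt.contDiffWithinAt

lemma germPartial_toGerm (i : Fin n) (f : regularFunctions 𝕜 n r S) :
    germPartial 𝕜 n r S i (toGerm 𝕜 n r S f) = toGerm 𝕜 n r S (partialFun 𝕜 n r S i f) :=
  germPartialFun_toGerm 𝕜 n r S i f

lemma fderiv_fderiv_apply_comm {E F : Type*} [NormedAddCommGroup E] [NormedSpace 𝕜 E]
    [NormedAddCommGroup F] [NormedSpace 𝕜 F] {f : E → F} {x : E} (hf : ContDiffAt 𝕜 2 f x)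
    (v w : E) :
    fderiv 𝕜 (fun y => fderiv 𝕜 f y w) x v = fderiv 𝕜 (fun y => fderiv 𝕜 f y v) x w := by
  have h_diff : DifferentiableAt 𝕜 (fderiv 𝕜 f) x :=
    (hf.fderiv_right (m := 1) (by norm_num)).differentiableAt one_ne_zero
  have h_apply : ∀ v w, fderiv 𝕜 (fun y => fderiv 𝕜 f y w) x v = fderiv 𝕜 (fderiv 𝕜 f) x v w :=
    fun v w => by
      rw [fderiv_clm_apply h_diff (differentiableAt_const w)]
      simp
  rw [h_apply, h_apply, (hf.isSymmSndFDerivAt (by simp)).eq]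

lemma germPartial_comm (i j : Fin n) (a : Germs 𝕜 n r S) :
    germPartial 𝕜 n r S i (germPartial 𝕜 n r S j a) =
      germPartial 𝕜 n r S j (germPartial 𝕜 n r S i a) := by
  obtain ⟨f, rfl⟩ := toGerm_surjective 𝕜 n r S a
  simp only [germPartial_toGerm]
  refine toGerm_eq.2 (Filter.Eventually.mono f.2 fun x hx => ?_)
  exact fderiv_fderiv_apply_comm (hx.of_le (natCast_le_order 2 r)) _ _

lemma exists_stable_neighbourhood {ι : Type*} [Finite ι] [DecidableEq ι] {S : Set (ι → 𝕜)}
    (hS : S = {0} ∨ S = Set.univ) {p : (ι → 𝕜) → Prop} (hp : ∀ᶠ x in 𝓝ˢ S, p x) :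
    ∃ U : Set (ι → 𝕜),
      IsOpen U ∧ S ⊆ U ∧ (∀ x ∈ U, p x) ∧ ∀ i, StableUnderScaling i U := by
  have := Fintype.ofFinite ι
  rcases hS with rfl | rfl
  · rw [nhdsSet_singleton] at hp
    obtain ⟨ε, hε, hp⟩ := Metric.eventually_nhds_iff_ball.1 hp
    exact ⟨Metric.ball 0 ε, Metric.isOpen_ball,
      Set.singleton_subset_iff.2 (Metric.mem_ball_self hε), hp, fun i => stableUnderScaling_ball ε⟩
  · rw [nhdsSet_univ, Filter.eventually_top] at hp
    exact ⟨Set.univ, isOpen_univ, le_rfl, fun x _ => hp x, fun _ _ _ _ _ => Set.mem_univ _⟩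

lemma hasCoordPrimitives_germPartial (hS : S = {0} ∨ S = Set.univ) :
    HasCoordPrimitives (germPartial 𝕜 n r S) := by
  intro i a
  obtain ⟨f, rfl⟩ := toGerm_surjective 𝕜 n r S a
  have hf_regular : ∀ᶠ x in 𝓝ˢ S, ContDiffAt 𝕜 r.order (f : (Fin n → 𝕜) → 𝕜) x := f.2
  have h_order : 1 ≤ r.order := by exact_mod_cast natCast_le_order 1 r
  obtain ⟨U, hU, hSU, hfU, hU_stable⟩ := exists_stable_neighbourhood hS hf_regular
  have hf : ContDiffOn 𝕜 r.order (f : (Fin n → 𝕜) → 𝕜) U := fun x hx => (hfU x hx).contDiffWithinAt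
  let H : regularFunctions 𝕜 n r S := ⟨coordPrimitive i f,
    eventually_nhdsSet_iff_exists.2 ⟨U, hU, hSU, fun x hx =>
      (contDiffOn_coordPrimitive hU (hU_stable i) hf).contDiffAt (hU.mem_nhds hx)⟩⟩
  refine ⟨toGerm 𝕜 n r S H, ?_, fun j hj hf_indep => ?_⟩
  · rw [germPartial_toGerm, toGerm_eq]
    exact eventually_nhdsSet_iff_exists.2 ⟨U, hU, hSU, fun x hx =>
      fderiv_coordPrimitive_self hU (hU_stable i) (hf.of_le h_order) hx⟩
  · rw [germPartial_toGerm, ← map_zero (toGerm 𝕜 n r S), toGerm_eq] at hf_indep ⊢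
    obtain ⟨V, hV, hSV, hfV, hV_stable⟩ := exists_stable_neighbourhood hS (hf_regular.and hf_indep)
    exact eventually_nhdsSet_iff_exists.2 ⟨V, hV, hSV, fun x hx =>
      fderiv_coordPrimitive_of_ne hj hV (hV_stable i)
        (fun y hy => ((hfV y hy).1.of_le h_order).contDiffWithinAt)
        (fun y hy => (hfV y hy).2) hx⟩

end Germs

end NambuDeformation

open NambuDeformation in
theorem mainTheorem8_general {𝕜 : Type*} [Field 𝕜] {O : Type*} [CommRing O] [Algebra 𝕜 O]
    {n q : ℕ} (hqn : q ≤ n) (hq : 1 ≤ q) {D : Fin n → Derivation 𝕜 O O}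
    (hD : ∀ i j f, D i (D j f) = D j (D i f)) (hprim : HasCoordPrimitives D)
    {Ω : DForm O n} (hΩ : IsVolumeForm Ω) :
    IsNambu D Ω q (constantNambu O hqn) ∧
      trivialDeformations D (constantNambu O hqn) ≤
        infinitesimalDeformations D Ω q (constantNambu O hqn) ∧
      Subsingleton (DH D Ω q (constantNambu O hqn)) := by
  refine ⟨isNambu_constantNambu hqn hΩ, trivialDeformations_le hqn hD hΩ, ?_⟩
  rw [Submodule.Quotient.subsingleton_iff, Submodule.submoduleOf, Submodule.comap_subtype_eq_top]
  exact infinitesimalDeformations_le hqn hq hD hprim hΩ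

open NambuDeformation in
theorem mainTheorem8 (𝕜 : Type*) [RCLike 𝕜] (n q : ℕ) (hq : 1 ≤ q) (hqn : q ≤ n) :
    -- smooth and analytic case: germs at the origin, and fields defined on all of `𝕜ⁿ`
    (∀ (r : Regularity) (S : Set (Fin n → 𝕜)), S = {0} ∨ S = Set.univ →
      ∀ Ω : DForm (Germs 𝕜 n r S) n, IsVolumeForm Ω →
        IsNambu (germPartial 𝕜 n r S) Ω q (constantNambu (Germs 𝕜 n r S) hqn) ∧
        trivialDeformations (germPartial 𝕜 n r S) (constantNambu (Germs 𝕜 n r S) hqn) ≤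
          infinitesimalDeformations (germPartial 𝕜 n r S) Ω q
            (constantNambu (Germs 𝕜 n r S) hqn) ∧
        Subsingleton (DH (germPartial 𝕜 n r S) Ω q (constantNambu (Germs 𝕜 n r S) hqn))) ∧
    -- formal case
    (∀ Ω : DForm (MvPowerSeries (Fin n) 𝕜) n, IsVolumeForm Ω →
      IsNambu (MvPowerSeries.pderiv 𝕜) Ω q (constantNambu (MvPowerSeries (Fin n) 𝕜) hqn) ∧
      trivialDeformations (MvPowerSeries.pderiv 𝕜)
          (constantNambu (MvPowerSeries (Fin n) 𝕜) hqn) ≤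
        infinitesimalDeformations (MvPowerSeries.pderiv 𝕜) Ω q
          (constantNambu (MvPowerSeries (Fin n) 𝕜) hqn) ∧
      Subsingleton (DH (MvPowerSeries.pderiv 𝕜) Ω q
        (constantNambu (MvPowerSeries (Fin n) 𝕜) hqn))) := by
  refine ⟨fun r S hS Ω hΩ => ?_, fun Ω hΩ => ?_⟩
  · exact mainTheorem8_general hqn hq germPartial_comm (hasCoordPrimitives_germPartial hS) hΩ
  · exact mainTheorem8_general hqn hq pderiv_comm hasCoordPrimitives_pderiv hΩ
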